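/- **Setting.** Let $(\mathcal A_n)_{n\ge 0}$ be finite alphabets of bounded cardinality and let $\boldsymbol\theta=(\theta^{(n)})_{n\ge0}$ be a directive sequence of constant-length morphisms: each $\theta^{(n)}$ maps every letter of $\mathcal A_{n+1}$ to a word of length $q_n\ge 1$ over $\mathcal A_n$. Let $X^{(n)}_{\boldsymbol\theta}\subset\mathcal A_n^{\mathbb Z}$ be the set of bi-infinite sequences all of whose finite subwords are subwords of $\theta^{(n)}\circ\cdots\circ\theta^{(N-1)}(a)$ for some $N>n$ and $a\in\mathcal A_N$, let $\sigma$ be the left shift, and put $X_{\boldsymbol\theta}=X^{(0)}_{\boldsymbol\theta}$. Suppose that $\boldsymbol\theta$ is *torsion-free*, i.e. $q_n>1$ for infinitely many $n$; each $(X^{(n)}_{\boldsymbol\theta},\sigma)$ is minimal (in particular non-empty); no point of $X^{(0)}_{\boldsymbol\theta}$ is shift-periodic; and every prime which divides some $q_k$ divides $q_n$ for infinitely many $n$. **Dynamical height.** Let $\mathbb Z_{(q_n)}=\varprojlim \mathbb Z/(q_0\cdots q_{n-1})\mathbb Z$. The (dynamical) height $h(\boldsymbol\theta)$ is the integer $h\ge1$,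 coprime to every $q_n$, such that the maximal equicontinuous factor of $(X_{\boldsymbol\theta},\sigma)$ is $\mathbb Z_{(q_n)}\times\mathbb Z/h\mathbb Z$ with the map $z\mapsto z+(1,1)$. **Injectivisation.** Define equivalence relations $\sim_n$ on $\mathcal A_n$ recursively: $\sim_0$ is equality, and for $a,b\in\mathcal A_{n+1}$, $a\sim_{n+1}b$ if and only if, for every $i$, the $i$-th letters of $\theta^{(n)}(a)$ and $\theta^{(n)}(b)$ are $\sim_n$-equivalent. The injectivisation $\boldsymbol{\widehat\theta}$ of $\boldsymbol\theta$ is the directive sequence on the alphabets $\mathcal A_n/{\sim_n}$ induced by $\boldsymbol\theta$; its morphisms $\widehat\theta^{(n)}$ are injective on letters and have the same lengths $q_n$, and it is $\boldsymbol\theta$ itself, up to renaming letters, if all $\theta^{(n)}$ are injective on letters. **Combinatorial height.** Let $(u^{(n)})_{n\ge0}$ be a sequence with $u^{(n)}\in X^{(n)}_{\boldsymbol{\widehat\theta}}$ and $\widehat\theta^{(n)}(u^{(n+1)})=u^{(n)}$ for all $n$ (so $u^{(0)}$ is a limit word of $\boldsymbol{\widehat\theta}$). Put $$h^{(n)}=\max\{d\ge1:\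 \gcd(d,q_N)=1 \text{ for all } N\ge n,\ \text{and } d\mid k \text{ for every } k\in\mathbb Z \text{ with } u^{(n)}_k=u^{(n)}_0\},\qquad h_{\rm comb}(\boldsymbol\theta)=\max_{n\ge0}h^{(n)}.$$ **Theorem.** The height $h(\boldsymbol\theta)$ exists and is unique, sequences $(u^{(n)})$ as above exist, and for every such sequence all the maxima above exist and $$h_{\rm comb}(\boldsymbol\theta)=h(\boldsymbol\theta).$$ -/

import Mathlib

open Set Filter Topology

noncomputable section

/-- A constant-length directive sequence: finite alphabets `A n` and morphisms
`θ n : A (n + 1) → (A n)⁺` such that every letter is sent to a (non-empty) word of length `q n`.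
The `i`-th letter of the word `θ n a` is `θ n a i`. -/
structure DirectiveSeq where
  A : ℕ → Type
  finite_A : ∀ n, Finite (A n)
  q : ℕ → ℕ
  q_pos : ∀ n, 0 < q n
  θ : ∀ n, A (n + 1) → Fin (q n) → A n

namespace DirectiveSeq

variable (D : DirectiveSeq)

instance instFiniteA (n : ℕ) : Finite (D.A n) := D.finite_A n

/-- Alphabets are discrete; the space `ℤ → D.A n` has the product topology. -/
instance instTopologicalSpaceA (n : ℕ) : TopologicalSpace (D.A n) := ⊥

instance instDiscreteTopologyA (n : ℕ) : DiscreteTopology (D.A n) := ⟨rfl⟩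

/-- The alphabets have bounded size. -/
def BoundedAlphabets : Prop := ∃ K : ℕ, ∀ n, Nat.card (D.A n) ≤ K

/-- The word `θ^{[n, n+k)}(a)` for a letter `a` of `A (n + k)`. -/
def supertile (n : ℕ) : (k : ℕ) → D.A (n + k) → List (D.A n)
  | 0, a => [a]
  | k + 1, a => (List.ofFn (D.θ (n + k) a)).flatMap (supertile n k)

/-- The set of subwords of the words `θ^{[n, N)}(a)`, `a` in `A N`, `N > n`. -/
def preLanguage (n : ℕ) : Set (List (D.A n)) :=
  {w | ∃ k : ℕ, 1 ≤ k ∧ ∃ a : D.A (n + k), w <:+: D.supertile n k a}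

/-- The level-`n` shift `X^{(n)}`: all bi-infinite sequences, each of whose
(finite) subwords lies in `preLanguage n`. -/
def X (n : ℕ) : Set (ℤ → D.A n) :=
  {x | ∀ (i : ℤ) (l : ℕ), List.ofFn (fun j : Fin l => x (i + (j : ℕ))) ∈ D.preLanguage n}

/-- The action of the morphism `θ n` on bi-infinite sequences by concatenation; the image of the
letter at position `0` starts at position `0`. -/
def subst (n : ℕ) (x : ℤ → D.A (n + 1)) : ℤ → D.A n := fun m =>
  D.θ n (x (m / (D.q n : ℤ)))
    ⟨(m % (D.q n : ℤ)).toNat, by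
      have hq : (0 : ℤ) < D.q n := by exact_mod_cast D.q_pos n
      have h1 := Int.emod_nonneg m hq.ne'
      have h2 := Int.emod_lt_of_pos m hq
      omega⟩

end DirectiveSeq

/-- The left shift on bi-infinite sequences. -/
def leftShift {α : Type} (x : ℤ → α) : ℤ → α := fun m => x (m + 1)

/-- `X` is a minimal shift: it is non-empty and has no closed shift-invariant subsets
except the empty set and `X`. -/
def IsMinimalShift {α : Type} [TopologicalSpace α] (X : Set (ℤ → α)) : Prop :=
  X.Nonempty ∧ ∀ Y ⊆ X, IsClosed Y → leftShift '' Y = Y → Y = ∅ ∨ Y = X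

namespace DirectiveSeq

variable (D : DirectiveSeq)

/-- A torsion-free (constant-length) directive sequence. -/
structure TorsionFree : Prop where
  one_lt_q : ∃ᶠ n in atTop, 1 < D.q n
  minimal : ∀ n, IsMinimalShift (D.X n)
  aperiodic : ∀ x ∈ D.X 0, ∀ k : ℕ, 1 ≤ k → leftShift^[k] x ≠ x
  prime_dvd : ∀ p : ℕ, p.Prime → ∀ k, p ∣ D.q k → ∃ᶠ n in atTop, p ∣ D.q n

theorem leftShift_mem {n : ℕ} {x : ℤ → D.A n} (hx : x ∈ D.X n) : leftShift x ∈ D.X n := by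
  intro i l
  have h := hx (i + 1) l
  have e : (fun j : Fin l => leftShift x (i + (j : ℕ))) =
      fun j : Fin l => x (i + 1 + (j : ℕ)) := by
    funext j
    simp only [leftShift]
    congr 1
    ring
  rw [e]
  exact h

/-- The shift map on the `S`-adic shift `X^{(n)}`. -/
def shiftX (n : ℕ) (x : D.X n) : D.X n := ⟨leftShift x.1, D.leftShift_mem x.2⟩

end DirectiveSeq

/-- `(Z, S)` is an equicontinuous system: `Z` is compact Hausdorff, and the family of all iterates
`S ^ n`, `n ∈ ℤ`, is equicontinuous with respect to the uniformity of `Z` (a compact Hausdorff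
space has exactly one uniformity inducing its topology). -/
def IsEquicontinuousSystem {Z : Type} [t : TopologicalSpace Z] (S : Z ≃ₜ Z) : Prop :=
  CompactSpace Z ∧ T2Space Z ∧
    ∃ u : UniformSpace Z, u.toTopologicalSpace = t ∧ Equicontinuous fun n : ℤ => ⇑(S ^ n)

/-- `π` is a factor map from `(X, T)` onto `(Z, S)`. -/
def IsFactorMap {X Z : Type} [TopologicalSpace X] [TopologicalSpace Z]
    (T : X → X) (S : Z → Z) (π : X → Z) : Prop :=
  Continuous π ∧ Function.Surjective π ∧ Function.Semiconj π T S

/-- `(Z, S)` is the maximal equicontinuous factor of `(X, T)`: it is an equicontinuous factor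
through which every equicontinuous factor of `(X, T)` factors. -/
def IsMaximalEquicontinuousFactor {X Z : Type} [TopologicalSpace X] [TopologicalSpace Z]
    (T : X → X) (S : Z ≃ₜ Z) : Prop :=
  IsEquicontinuousSystem S ∧ ∃ π : X → Z, IsFactorMap T S π ∧
    ∀ (Y : Type) [TopologicalSpace Y] (R : Y ≃ₜ Y) (ρ : X → Y),
      IsEquicontinuousSystem R → IsFactorMap T R ρ →
        ∃ ψ : Z → Y, IsFactorMap S R ψ ∧ ψ ∘ π = ρ

/-- `p_n = q_0 q_1 ⋯ q_{n-1}`. -/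
def lengthProd (q : ℕ → ℕ) (n : ℕ) : ℕ := ∏ i ∈ Finset.range n, q i

theorem lengthProd_dvd (q : ℕ → ℕ) (n : ℕ) : lengthProd q n ∣ lengthProd q (n + 1) :=
  ⟨q n, Finset.prod_range_succ q n⟩

/-- The odometer group `ℤ_{(q_n)}`, the inverse limit of the groups `ℤ / p_n ℤ`
(with the topology induced by the product of discrete topologies). -/
def odometer (q : ℕ → ℕ) : AddSubgroup (∀ n, ZMod (lengthProd q n)) where
  carrier := {x | ∀ n, ZMod.castHom (lengthProd_dvd q n) (ZMod (lengthProd q n)) (x (n + 1)) = x n}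
  zero_mem' := fun _ => map_zero _
  add_mem' := fun hx hy n => by
    rw [Pi.add_apply, map_add, hx n, hy n, Pi.add_apply]
  neg_mem' := fun hx n => by
    rw [Pi.neg_apply, map_neg, hx n, Pi.neg_apply]

/-- The element `1` of the odometer group. -/
def odometerOne (q : ℕ → ℕ) : odometer q := ⟨fun _ => 1, fun _ => map_one _⟩

namespace DirectiveSeq

variable (D : DirectiveSeq)

/-- `h` is the (dynamical) height of `D`: it is a positive integer coprime to each `q n`, and the
maximal equicontinuous factor of `X^{(0)}` is the rotation by `(1, 1)` on `ℤ_{(q_n)} × ℤ / h ℤ`. -/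
def IsHeight (h : ℕ) : Prop :=
  0 < h ∧ (∀ n, Nat.Coprime h (D.q n)) ∧
    IsMaximalEquicontinuousFactor (D.shiftX 0)
      (Homeomorph.addRight ((odometerOne D.q, 1) : odometer D.q × ZMod h))

/-- The recursively defined equivalence relation on the letters of level `n` whose classes are the
letters of level `n` of the injectivisation. At level `0` it is equality. If `τ_n` is the projection
to the classes at level `n`, then `a` and `b` are equivalent at level `n + 1` when the words
`τ_n (θ n a)` and `τ_n (θ n b)` coincide. -/
def letterSetoid : (n : ℕ) → Setoid (D.A n)
  | 0 => ⊥
  | n + 1 => Setoid.ker fun (a : D.A (n + 1)) (i : Fin (D.q n)) =>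
      (Quotient.mk (letterSetoid n) (D.θ n a i))

/-- The injectivisation of `D`: with `τ_n` the projection of `A n` to its quotient alphabet, its
`n`-th morphism sends `τ_{n+1} a` to `τ_n (θ n a)`, and this is injective on letters. The alphabet at
level `0` is a copy of `A 0`; when all morphisms of `D` are injective on letters, all the projections
`τ_n` are bijections, so that the injectivisation is `D` itself up to the names of letters. -/
def injectivisation : DirectiveSeq where
  A n := Quotient (D.letterSetoid n)
  finite_A _ := Quotient.finite _
  q := D.q
  q_pos := D.q_pos
  θ n := Quotient.lift
    (fun (a : D.A (n + 1)) (i : Fin (D.q n)) => Quotient.mk (D.letterSetoid n) (D.θ n a i))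
    fun _ _ h => h

theorem injectivisation_injective (n : ℕ) : Function.Injective (D.injectivisation.θ n) := by
  intro a b
  induction a using Quotient.inductionOn
  induction b using Quotient.inductionOn
  exact fun h => Quotient.sound h

/-- `u 0` is a two-sided limit word of `D`, as witnessed by the sequence `u n ∈ X^{(n)}` with
`θ n (u (n + 1)) = u n`. -/
def IsLimitWord (u : ∀ n, ℤ → D.A n) : Prop :=
  (∀ n, u n ∈ D.X n) ∧ ∀ n, D.subst n (u (n + 1)) = u n

/-- The positive integers `d` that are coprime to all `q N`, `N ≥ n`, and divide all return times of
the letter at position `0` in the level-`n` word `u n`. -/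
def returnDivisors (u : ∀ n, ℤ → D.A n) (n : ℕ) : Set ℕ :=
  {d | 1 ≤ d ∧ (∀ N, n ≤ N → Nat.Coprime d (D.q N)) ∧
    ∀ k : ℤ, u n k = u n 0 → (d : ℤ) ∣ k}

/-- `h` is the combinatorial height computed with the sequence `u`: at each level `n` the set of
admissible divisors has a maximum `h^{(n)}`, and `h` is the maximum of the numbers `h^{(n)}`. -/
def IsCombHeightOf (u : ∀ n, ℤ → D.A n) (h : ℕ) : Prop :=
  ∃ hn : ℕ → ℕ, (∀ n, IsGreatest (D.returnDivisors u n) (hn n)) ∧ IsGreatest (Set.range hn) h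

end DirectiveSeq

end

/-! Everything is expressed through cyclic factors, i.e. continuous maps `f` to `ℤ/d` with `f ∘ T =
f + 1`. The height is the largest `d` coprime to all `q_n` for which one exists. The main tool is
`exists_cyclic_decomposition`: for a minimal `T` and `m > 0`, the minimal components of `T ^ m` are
permuted cyclically, which gives a cyclic factor of some order `c ∣ m` whose fibres lie in `T ^
m`-orbit closures.

Three facts identify the maximal equicontinuous factor. Let `K` bound the alphabets and `p_n = q_0 ⋯
q_{n-1}`. (1) Each `p_k` is the order of a cyclic factor (`hasCyclicFactor_lengthProd`). Let `c_n`
be the number of components of `T ^ p_n`. If `p_n / c_n > K`, then at most `K` level-`n` letters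
would determine long runs of blocks of length `c_n`, and Morse–Hedlund would produce a periodic
point. So `p_n / c_n ≤ K`, and as primes recur, `p_k` divides some `c_n`. (2) Orders coprime to all
`q_n` are at most `K`, by pigeonhole on letters, and are closed under lcm, so they have a largest
element for divisibility. (3) Points separated by an equicontinuous factor are separated by a cyclic
one (`exists_cyclic_separating`): equal letters at a high level give almost-periods, and since there
are few letters a whole subgroup of `ℤ` consists of almost-periods.

For the combinatorial height, a cyclic factor of order `d` coprime to the `q_n` is read off from
letters at high levels, so `d` divides all return times there. Conversely, if `d` divides the return
times at level `n`, comparing the components of `T ^ (p_n d)` with the level-`n` word yields a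
cyclic factor of order `d` (`hasCyclicFactor_of_mem_returnDivisors`). This needs desubstitution to
be unique, hence the injectivisation, whose level `0` is conjugate to the original. -/

open Set Filter Topology

noncomputable section

/-! ### Cyclic factors of minimal systems. -/

section Dynamics

variable {X : Type*} [TopologicalSpace X]

/-- A homeomorphism is minimal if it has no closed invariant sets besides `∅` and `X`. -/
def IsMinimalHomeo (T : X ≃ₜ X) : Prop :=
  ∀ C : Set X, IsClosed C → T ⁻¹' C = C → C = ∅ ∨ C = univ

/-- `(X, T)` has the rotation by `1` on `ℤ / d ℤ` as a factor. -/
def HasCyclicFactor (T : X ≃ₜ X) (d : ℕ) : Prop :=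
  ∃ f : X → ZMod d, Continuous f ∧ ∀ x, f (T x) = f x + 1

theorem zpow_add_homeo (T : X ≃ₜ X) (i j : ℤ) (x : X) : (T ^ (i + j)) x = (T ^ i) ((T ^ j) x) := by
  rw [zpow_add]; rfl

theorem zpow_one_add_homeo (T : X ≃ₜ X) (i : ℤ) (x : X) : (T ^ i) (T x) = (T ^ (i + 1)) x := by
  rw [zpow_add_homeo, zpow_one]

theorem zpow_neg_homeo (T : X ≃ₜ X) (i : ℤ) (x : X) : (T ^ i) ((T ^ (-i)) x) = x := by
  rw [← zpow_add_homeo]; simp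

theorem zpow_semiconj {Y : Type*} [TopologicalSpace Y] (T : X ≃ₜ X) (S : Y ≃ₜ Y) (f : X → Y)
    (hf : ∀ x, f (T x) = S (f x)) (i : ℤ) (x : X) : f ((T ^ i) x) = (S ^ i) (f x) := by
  induction i using Int.induction_on generalizing x with
  | zero => simp
  | succ k ih => rw [← zpow_one_add_homeo, ih, hf, zpow_one_add_homeo]
  | pred k ih =>
    have h := ih ((T ^ (-1 : ℤ)) x)
    rw [sub_eq_add_neg, zpow_add_homeo, ih, zpow_add_homeo]
    congr 1
    have h2 := hf ((T ^ (-1 : ℤ)) x)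
    have h3 : T ((T ^ (-1 : ℤ)) x) = x := by
      have := zpow_neg_homeo T 1 x
      rwa [zpow_one] at this
    rw [h3] at h2
    rw [h2, zpow_one_add_homeo]
    simp

theorem cyclic_zpow {T : X ≃ₜ X} {d : ℕ} {f : X → ZMod d} (hf : ∀ x, f (T x) = f x + 1)
    (i : ℤ) (x : X) : f ((T ^ i) x) = f x + i := by
  induction i using Int.induction_on generalizing x with
  | zero => simp
  | succ k ih => rw [← zpow_one_add_homeo, ih, hf]; push_cast; ring
  | pred k ih =>
    have h2 := hf ((T ^ (-1 : ℤ)) x)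
    have h3 : T ((T ^ (-1 : ℤ)) x) = x := by
      have := zpow_neg_homeo T 1 x
      rwa [zpow_one] at this
    rw [h3] at h2
    rw [sub_eq_add_neg, zpow_add_homeo, ih, h2]; push_cast; ring

/-- The fibre over `f y` is closed and invariant. Applied to a difference, it shows that two cyclic
factor maps of the same order differ by a constant. -/
theorem IsMinimalHomeo.const {T : X ≃ₜ X} (hT : IsMinimalHomeo T) {Y : Type*} [TopologicalSpace Y]
    [T1Space Y] {f : X → Y} (hc : Continuous f) (hf : ∀ x, f (T x) = f x) (x y : X) : f x = f y := by
  have := hT (f ⁻¹' {f y}) (isClosed_singleton.preimage hc) (by ext z; simp [hf])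
  rcases this with h | h
  · have : y ∈ f ⁻¹' {f y} := rfl
    rw [h] at this; exact this.elim
  · have : x ∈ f ⁻¹' {f y} := by rw [h]; trivial
    exact this

/-- A closed set which is invariant and meets an orbit is everything. -/
theorem IsMinimalHomeo.mem_of_mem {T : X ≃ₜ X} (hT : IsMinimalHomeo T) {C : Set X} (hC : IsClosed C)
    (hi : T ⁻¹' C = C) {x : X} (hx : x ∈ C) (y : X) : y ∈ C := by
  rcases hT C hC hi with h | h
  · rw [h] at hx; exact hx.elim
  · rw [h]; trivial

theorem HasCyclicFactor.of_dvd {T : X ≃ₜ X} {a b : ℕ} (h : HasCyclicFactor T b) (hab : a ∣ b) :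
    HasCyclicFactor T a := by
  obtain ⟨f, hc, hf⟩ := h
  refine ⟨fun x => ZMod.castHom hab (ZMod a) (f x), ?_, fun x => ?_⟩
  · exact (continuous_of_discreteTopology (f := ZMod.castHom hab (ZMod a))).comp hc
  · simp only [hf, map_add, map_one]

theorem HasCyclicFactor.conj {Y : Type*} [TopologicalSpace Y] {T : X ≃ₜ X} {S : Y ≃ₜ Y} {d : ℕ}
    (h : HasCyclicFactor S d) (e : X → Y) (he : Continuous e) (hs : ∀ x, e (T x) = S (e x)) :
    HasCyclicFactor T d := by
  obtain ⟨f, hc, hf⟩ := h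
  exact ⟨f ∘ e, hc.comp he, fun x => by simp [hs, hf]⟩

theorem cyclic_const_closure {T : X ≃ₜ X} {a m : ℕ} (ham : a ∣ m) {g : X → ZMod a}
    (hc : Continuous g) (hg : ∀ x, g (T x) = g x + 1) {x y : X}
    (hy : y ∈ closure (range fun j : ℤ => (T ^ ((m : ℤ) * j)) x)) : g y = g x := by
  refine closure_minimal (t := g ⁻¹' {g x}) ?_ (isClosed_singleton.preimage hc) hy
  rintro _ ⟨j, rfl⟩
  simp only [mem_preimage, mem_singleton_iff]
  rw [cyclic_zpow hg]
  have : ((m : ℕ) : ZMod a) = 0 := (ZMod.natCast_eq_zero_iff _ _).2 ham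
  push_cast
  simp [this]

/-- The points `x` and `T ^ c x` have the same `f`-value, so they share a `T ^ m`-orbit closure, on
which every map witnessing the factor `ℤ/a` with `a ∣ m` is constant. -/
theorem dvd_of_closure [Nonempty X] {T : X ≃ₜ X} {a m c : ℕ} (ham : a ∣ m)
    (ha : HasCyclicFactor T a) {f : X → ZMod c} (hf : ∀ x, f (T x) = f x + 1)
    (hcl : ∀ x y, f x = f y → y ∈ closure (range fun j : ℤ => (T ^ ((m : ℤ) * j)) x)) : a ∣ c := by
  obtain ⟨g, hc, hg⟩ := ha
  obtain ⟨x⟩ := ‹Nonempty X›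
  have h1 : f x = f ((T ^ (c : ℤ)) x) := by rw [cyclic_zpow hf]; simp
  have h2 := cyclic_const_closure ham hc hg (hcl _ _ h1)
  rw [cyclic_zpow hg] at h2
  simpa [ZMod.natCast_eq_zero_iff] using h2

variable [CompactSpace X]

theorem exists_minimal_invariant [Nonempty X] (R : X ≃ₜ X) :
    ∃ M : Set X, M.Nonempty ∧ IsClosed M ∧ R ⁻¹' M = M ∧
      ∀ N ⊆ M, N.Nonempty → IsClosed N → R ⁻¹' N = N → N = M := by
  obtain ⟨M, -, hM⟩ := zorn_superset_nonempty
    {M : Set X | M.Nonempty ∧ IsClosed M ∧ R ⁻¹' M = M} (fun c hc hch hne => by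
      refine ⟨⋂₀ c, ⟨?_, isClosed_sInter fun s hs => (hc hs).2.1, ?_⟩, fun s hs => sInter_subset_of_mem hs⟩
      · have : Nonempty c := hne.to_subtype
        rw [sInter_eq_iInter]
        refine IsCompact.nonempty_iInter_of_directed_nonempty_isCompact_isClosed _ ?_
          (fun s => (hc s.2).1) (fun s => (hc s.2).2.1.isCompact) fun s => (hc s.2).2.1
        intro s t
        rcases hch.total s.2 t.2 with h | h
        · exact ⟨s, subset_rfl, h⟩
        · exact ⟨t, h, subset_rfl⟩
      · rw [preimage_sInter, sInter_eq_biInter]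
        exact iInter₂_congr fun s hs => (hc hs).2.2) univ
    ⟨univ_nonempty, isClosed_univ, rfl⟩
  refine ⟨M, hM.prop.1, hM.prop.2.1, hM.prop.2.2, fun N hN h1 h2 h3 => ?_⟩
  exact hN.antisymm (hM.le_of_le ⟨h1, h2, h3⟩ hN)

/-- The decomposition of a minimal system into the minimal components of a power of the map. -/
theorem exists_cyclic_decomposition {T : X ≃ₜ X} (hT : IsMinimalHomeo T) {m : ℕ} (hm : 0 < m) :
    ∃ c : ℕ, c ∣ m ∧ ∃ f : X → ZMod c, Continuous f ∧ (∀ x, f (T x) = f x + 1) ∧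
      ∀ x y, f x = f y → y ∈ closure (range fun j : ℤ => (T ^ ((m : ℤ) * j)) x) := by
  rcases isEmpty_or_nonempty X with hX | hX
  · exact ⟨1, one_dvd _, fun _ => 0, continuous_const, fun x => isEmptyElim x, fun x => isEmptyElim x⟩
  obtain ⟨M, hne, hcl, hinv, hmin⟩ := exists_minimal_invariant (T ^ (m : ℤ))
  have hinv' : ∀ x, (T ^ (m : ℤ)) x ∈ M ↔ x ∈ M := fun x => by
    conv_rhs => rw [← hinv]
    rfl
  have hcomm : ∀ (i j : ℤ) (x : X), (T ^ i) ((T ^ j) x) = (T ^ j) ((T ^ i) x) := fun i j x => by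
    rw [← zpow_add_homeo, ← zpow_add_homeo, add_comm]
  -- Translates of `M` by powers of `T` coincide with `M` or are disjoint from it, because `M ∩ T ^
  -- (-i) M` is closed and `T ^ m`-invariant.
  have key0 : ∀ (i : ℤ) (x : X), x ∈ M → (T ^ i) x ∈ M → ∀ y ∈ M, (T ^ i) y ∈ M := by
    intro i x hx hix y hy
    have := hmin (M ∩ (T ^ i) ⁻¹' M) inter_subset_left ⟨x, hx, hix⟩
      (hcl.inter (hcl.preimage (T ^ i).continuous)) (by
        ext z
        simp only [mem_preimage, mem_inter_iff, hinv']
        rw [hcomm, hinv'])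
    rw [← this] at hy
    exact hy.2
  let S : AddSubgroup ℤ :=
    { carrier := {i | ∀ x, (T ^ i) x ∈ M ↔ x ∈ M}
      zero_mem' := fun x => by simp
      add_mem' := fun {i j} hi hj x => by rw [zpow_add_homeo, hi, hj]
      neg_mem' := fun {i} hi x => by
        have := hi ((T ^ (-i)) x)
        rw [zpow_neg_homeo] at this
        exact this.symm }
  have key : ∀ (i : ℤ) (x : X), x ∈ M → (T ^ i) x ∈ M → i ∈ S := by
    intro i x hx hix y
    refine ⟨fun hy => ?_, key0 i x hx hix y⟩
    have h1 := key0 (-i) ((T ^ i) x) hix (by rw [hcomm, zpow_neg_homeo]; exact hx) _ hy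
    rwa [hcomm, zpow_neg_homeo] at h1
  have hmS : (m : ℤ) ∈ S := hinv'
  obtain ⟨c0, hc0⟩ := Int.subgroup_cyclic S
  have hS : ∀ i, i ∈ S ↔ (c0.natAbs : ℤ) ∣ i := fun i => by
    rw [hc0, AddSubgroup.mem_closure_singleton, Int.natAbs_dvd]
    constructor
    · rintro ⟨k, rfl⟩; exact ⟨k, by rw [smul_eq_mul, mul_comm]⟩
    · rintro ⟨k, rfl⟩; exact ⟨k, by rw [smul_eq_mul, mul_comm]⟩
  set c := c0.natAbs
  have hcm : c ∣ m := by
    have := (hS m).1 hmS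
    exact_mod_cast this
  have hcpos : 0 < c := Nat.pos_of_dvd_of_pos hcm hm
  have : NeZero c := ⟨hcpos.ne'⟩
  have hcS : ∀ i : ℤ, i ∈ S ↔ (i : ZMod c) = 0 := fun i => by
    rw [hS, ZMod.intCast_zmod_eq_zero_iff_dvd]
  -- The translates of `M` cover: since `m` stabilises `M` only `m` of them occur, so their union is
  -- closed, and it is `T`-invariant.
  have hcov : ∀ x, ∃ i : ℤ, (T ^ (-i)) x ∈ M := by
    intro x
    obtain ⟨x0, hx0⟩ := hne
    have hU : {x | ∃ i : ℤ, (T ^ (-i)) x ∈ M} =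
        ⋃ i ∈ Finset.range m, (T ^ (i : ℤ)) ⁻¹' M := by
      ext z
      simp only [mem_ofPred_eq, mem_iUnion, mem_preimage, Finset.mem_range, exists_prop]
      constructor
      · rintro ⟨i, hi⟩
        have hm' : (0 : ℤ) < m := by exact_mod_cast hm
        have h1 := Int.emod_nonneg (-i) hm'.ne'
        have h2 := Int.emod_lt_of_pos (-i) hm'
        refine ⟨((-i) % m).toNat, by omega, ?_⟩
        rw [Int.toNat_of_nonneg h1]
        have h3 : (m : ℤ) * ((-i) / m) ∈ S := (hS _).2 ((Int.natCast_dvd_natCast.2 hcm).mul_right _)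
        rw [← h3, ← zpow_add_homeo, Int.mul_ediv_add_emod]
        exact hi
      · rintro ⟨i, -, hi⟩
        exact ⟨-i, by simpa using hi⟩
    refine hT.mem_of_mem (C := {x | ∃ i : ℤ, (T ^ (-i)) x ∈ M}) ?_ ?_ (x := x0) ⟨0, by simpa using hx0⟩ x
    · rw [hU]
      exact (Finset.range m).finite_toSet.isClosed_biUnion fun i _ => hcl.preimage (T ^ (i : ℤ)).continuous
    · ext z
      simp only [mem_preimage, mem_ofPred_eq, zpow_one_add_homeo]
      constructor
      · rintro ⟨i, hi⟩; exact ⟨i - 1, by rw [neg_sub, sub_eq_neg_add]; exact hi⟩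
      · rintro ⟨i, hi⟩; exact ⟨i + 1, by simpa using hi⟩
  -- `F x` is an arbitrary index of the translate containing `x`; only its class mod `c` is
  -- canonical.
  choose F hF using hcov
  have hFS : ∀ (x : X) (i : ℤ), (T ^ (-i)) x ∈ M ↔ (F x : ZMod c) = i := by
    intro x i
    have e : (T ^ (-i)) x = (T ^ (F x - i)) ((T ^ (-F x)) x) := by
      rw [← zpow_add_homeo]; congr 2; ring
    rw [← sub_eq_zero, ← Int.cast_sub, ← hcS]
    constructor
    · intro h; rw [e] at h; exact key _ _ (hF x) h
    · intro h; rw [e, h]; exact hF x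
  refine ⟨c, hcm, fun x => (F x : ZMod c), ?_, ?_, ?_⟩
  · have hfib : ∀ v : ZMod c, IsClosed ((fun x => (F x : ZMod c)) ⁻¹' {v}) := by
      intro v
      obtain ⟨i, rfl⟩ := ZMod.intCast_surjective v
      have : ((fun x => (F x : ZMod c)) ⁻¹' {(i : ZMod c)}) = (T ^ (-i)) ⁻¹' M := by
        ext x; simp only [mem_preimage, mem_singleton_iff, hFS]
      rw [this]
      exact hcl.preimage (T ^ (-i)).continuous
    refine continuous_iff_isClosed.2 fun s _ => ?_
    rw [← biUnion_of_singleton s, preimage_iUnion₂]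
    exact (toFinite s).isClosed_biUnion fun v _ => hfib v
  · intro x
    have := (hFS (T x) (F x + 1)).1 (by
      rw [zpow_one_add_homeo]; simpa using hF x)
    simp only [this]; push_cast; ring
  · intro x y hxy
    have hy : (T ^ (-F x)) y ∈ M := (hFS y (F x)).2 hxy.symm
    set N : Set X := closure (range fun j : ℤ => (T ^ ((m : ℤ) * j)) ((T ^ (-F x)) x)) with hN
    have hpre : (T ^ (m : ℤ)) ⁻¹' N = N := by
      rw [hN, (T ^ (m : ℤ)).preimage_closure]
      congr 1
      ext z
      simp only [mem_preimage, mem_range]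
      constructor
      · rintro ⟨j, hj⟩
        refine ⟨j - 1, (T ^ (m : ℤ)).injective ?_⟩
        rw [← hj]
        simp only [← zpow_add_homeo]
        exact congrArg (fun k : ℤ => (T ^ k) x) (by ring)
      · rintro ⟨j, rfl⟩
        refine ⟨j + 1, ?_⟩
        simp only [← zpow_add_homeo]
        exact congrArg (fun k : ℤ => (T ^ k) x) (by ring)
    have hNM : N = M := by
      refine hmin N ?_ ⟨_, subset_closure ⟨0, rfl⟩⟩ isClosed_closure hpre
      refine closure_minimal ?_ hcl
      rintro _ ⟨j, rfl⟩
      have h3 : (m : ℤ) * j ∈ S := (hS _).2 ((Int.natCast_dvd_natCast.2 hcm).mul_right _)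
      exact (h3 _).2 (hF x)
    rw [← hNM] at hy
    have h1 : (T ^ F x) ((T ^ (-F x)) y) ∈
        (T ^ F x) '' N := mem_image_of_mem _ hy
    rw [zpow_neg_homeo, hN, (T ^ F x).image_closure, ← range_comp] at h1
    convert h1 using 3
    funext j
    simp only [Function.comp]
    rw [hcomm, zpow_neg_homeo]

/-- The number of components of `T ^ lcm(a, b)` is a multiple of both `a` and `b`. -/
theorem HasCyclicFactor.lcm {T : X ≃ₜ X} (hT : IsMinimalHomeo T) [Nonempty X] {a b : ℕ} (ha0 : 0 < a)
    (hb0 : 0 < b) (ha : HasCyclicFactor T a) (hb : HasCyclicFactor T b) :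
    HasCyclicFactor T (a.lcm b) := by
  obtain ⟨c, hcm, f, hc, hf, hcl⟩ := exists_cyclic_decomposition hT (Nat.lcm_pos ha0 hb0)
  have h1 := dvd_of_closure (Nat.dvd_lcm_left a b) ha hf hcl
  have h2 := dvd_of_closure (Nat.dvd_lcm_right a b) hb hf hcl
  exact HasCyclicFactor.of_dvd ⟨f, hc, hf⟩ (Nat.lcm_dvd h1 h2)

end Dynamics

/-! ### Subgroups of almost-periods from finite colourings. -/

/-- If a function with a `K`-element set of colours is such that differences of integers with the
same colour satisfy `B · δ`, for a symmetric subadditive `B`, then there is a non-trivial subgroup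
all of whose elements satisfy `B` with a constant controlled by `K`. -/
theorem exists_subgroup_of_colouring {α : Type*} [Finite α] (y : ℤ → α) (B : ℤ → ℝ → Prop) {δ : ℝ}
    (hneg : ∀ i ε, B i ε → B (-i) ε) (hadd : ∀ i j ε ε', B i ε → B j ε' → B (i + j) (ε + ε'))
    (hmono : ∀ i ε ε', ε ≤ ε' → B i ε → B i ε') (hδ : 0 ≤ δ)
    (hy : ∀ i j, y i = y j → B (j - i) δ) :
    ∃ m : ℕ, 0 < m ∧ ∀ j : ℤ, B (m * j) (2 * Nat.card α * δ) := by
  classical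
  have := Fintype.ofFinite α
  let G : SimpleGraph α := SimpleGraph.fromRel fun a b => ∃ i j, y i = a ∧ y j = b ∧ B (j - i) δ
  have hG : ∀ a b, G.Adj a b → ∃ i j, y i = a ∧ y j = b ∧ B (j - i) δ := by
    rintro a b ⟨-, h | ⟨i, j, h1, h2, h3⟩⟩
    · exact h
    · exact ⟨j, i, h2, h1, by simpa using hneg _ _ h3⟩
  -- Each edge costs `δ`, and so does moving between two positions of the same colour at each
  -- vertex, whence `2 * length + 1`.
  have hwalk : ∀ (a b : α) (p : G.Walk a b) (i j : ℤ), y i = a → y j = b →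
      B (j - i) ((2 * p.length + 1) * δ) := by
    intro a b p
    induction p with
    | nil => intro i j hi hj; simpa using hy i j (hi.trans hj.symm)
    | cons h p ih =>
      intro i j hi hj
      obtain ⟨i', j', h1, h2, h3⟩ := hG _ _ h
      have h4 := hadd _ _ _ _ (hadd _ _ _ _ (hy i i' (hi.trans h1.symm)) h3) (ih j' j h2 hj)
      convert h4 using 1
      · ring
      · simp only [SimpleGraph.Walk.length_cons]; push_cast; ring
  let L := AddSubgroup.closure {i : ℤ | B i δ}
  have hreach : ∀ i ∈ L, ∀ a, G.Reachable (y a) (y (a + i)) := by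
    intro i hi
    induction hi using AddSubgroup.closure_induction with
    | mem i hi =>
      intro a
      by_cases h : y a = y (a + i)
      · rw [← h]
      · exact SimpleGraph.Adj.reachable ⟨h, Or.inl ⟨a, a + i, rfl, rfl, by simpa using hi⟩⟩
    | zero => intro a; simp
    | add i j _ _ hi hj =>
      intro a; rw [← add_assoc]; exact (hi a).trans (hj (a + i))
    | neg i _ hi =>
      intro a
      have := (hi (a + -i)).symm
      simpa using this
  have hL : ∀ i ∈ L, B i (2 * Nat.card α * δ) := by
    intro i hi
    -- However many generators are needed to write `i`, a path visits each colour at most once, so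
    -- the cost is bounded independently of `i`.
    obtain ⟨p, hp⟩ := (hreach i hi 0).exists_isPath
    have h1 := hp.length_lt
    have h2 := hwalk _ _ p 0 (0 + i) rfl rfl
    have e : 0 + i - 0 = i := by ring
    rw [e] at h2
    refine hmono _ _ _ ?_ h2
    refine mul_le_mul_of_nonneg_right ?_ hδ
    rw [Nat.card_eq_fintype_card]
    have : ((p.length + 1 : ℕ) : ℝ) ≤ (Fintype.card α : ℝ) := by exact_mod_cast h1
    push_cast at this
    linarith
  obtain ⟨i, j, hij, hyij⟩ := Finite.exists_ne_map_eq_of_infinite y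
  have hmem : j - i ∈ L := AddSubgroup.subset_closure (hy i j hyij)
  refine ⟨(j - i).natAbs, by omega, fun k => hL _ ?_⟩
  have h1 : ((j - i).natAbs : ℤ) ∈ L := by
    rcases Int.natAbs_eq (j - i) with h | h
    · rw [← h]; exact hmem
    · have := L.neg_mem hmem
      rw [h, neg_neg] at this
      exact this
  have := L.zsmul_mem h1 k
  rwa [smul_eq_mul, mul_comm] at this

/-! ### Divisibility by the products `p_n`. -/

section LengthProd

variable {q : ℕ → ℕ}

theorem lengthProd_succ (q : ℕ → ℕ) (n : ℕ) : lengthProd q (n + 1) = lengthProd q n * q n :=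
  Finset.prod_range_succ q n

theorem lengthProd_pos (hq : ∀ n, 0 < q n) (n : ℕ) : 0 < lengthProd q n :=
  Finset.prod_pos fun i _ => hq i

theorem lengthProd_dvd_of_le (q : ℕ → ℕ) {m n : ℕ} (h : m ≤ n) : lengthProd q m ∣ lengthProd q n := by
  induction n, h using Nat.le_induction with
  | base => rfl
  | succ n _ ih => exact ih.trans (lengthProd_dvd q n)

theorem coprime_lengthProd {d : ℕ} (h : ∀ n, Nat.Coprime d (q n)) (n : ℕ) :
    Nat.Coprime d (lengthProd q n) :=
  Nat.Coprime.prod_right fun i _ => h i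

theorem le_lengthProd (hq : ∀ n, 0 < q n) (h1 : ∃ᶠ n in atTop, 1 < q n) (B : ℕ) :
    ∃ n₀, ∀ n, n₀ ≤ n → B ≤ lengthProd q n := by
  suffices h : ∃ n₀, B ≤ lengthProd q n₀ by
    obtain ⟨n₀, h⟩ := h
    exact ⟨n₀, fun n hn => h.trans
      (Nat.le_of_dvd (lengthProd_pos hq n) (lengthProd_dvd_of_le q hn))⟩
  induction B with
  | zero => exact ⟨0, Nat.zero_le _⟩
  | succ B ih =>
    obtain ⟨n₀, h⟩ := ih
    obtain ⟨n, hn, hqn⟩ := frequently_atTop.1 h1 n₀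
    refine ⟨n + 1, ?_⟩
    have h2 := Nat.le_of_dvd (lengthProd_pos hq n) (lengthProd_dvd_of_le q hn)
    rw [lengthProd_succ]
    have := lengthProd_pos hq n
    nlinarith

/-- If every prime that divides some `q k` divides infinitely many of them, then every `c` divides
`p_n c₁` for some `n`, where `c₁` is a divisor of `c` coprime to all `q k`. -/
theorem exists_dvd_lengthProd_mul (hp : ∀ p : ℕ, p.Prime → ∀ k, p ∣ q k → ∃ᶠ n in atTop, p ∣ q n)
    {c : ℕ} (hc : 0 < c) :
    ∃ n c₁, c₁ ∣ c ∧ (∀ i, Nat.Coprime c₁ (q i)) ∧ c ∣ lengthProd q n * c₁ := by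
  -- Choose `n` maximising `gcd(c, p_n)`; a prime shared by the cofactor `c₁` and some `q i` recurs
  -- later and would enlarge this gcd.
  have hbdd : BddAbove (range fun n => Nat.gcd c (lengthProd q n)) := by
    refine ⟨c, ?_⟩
    rintro _ ⟨n, rfl⟩
    exact Nat.gcd_le_left _ hc
  obtain ⟨n, hn⟩ := Nat.sSup_mem (range_nonempty _) hbdd
  have hmax : ∀ m, Nat.gcd c (lengthProd q m) ≤ Nat.gcd c (lengthProd q n) := fun m => by
    have h1 := le_csSup hbdd ⟨m, rfl⟩
    rw [← hn] at h1
    exact h1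
  set g := Nat.gcd c (lengthProd q n) with hg
  obtain ⟨c₁, hc₁⟩ : g ∣ c := Nat.gcd_dvd_left _ _
  have hgpos : 0 < g := Nat.gcd_pos_of_pos_left _ hc
  refine ⟨n, c₁, ⟨g, by rw [hc₁, mul_comm]⟩, fun i => ?_, ?_⟩
  · by_contra hcop
    obtain ⟨p, hpp, hp1, hp2⟩ := Nat.Prime.not_coprime_iff_dvd.1 hcop
    obtain ⟨N, hN, hpN⟩ := frequently_atTop.1 (hp p hpp i hp2) n
    have h1 : g * p ∣ c := by rw [hc₁]; exact mul_dvd_mul_left g hp1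
    have h2 : g * p ∣ lengthProd q (N + 1) := by
      rw [lengthProd_succ]
      exact mul_dvd_mul ((Nat.gcd_dvd_right _ _).trans (lengthProd_dvd_of_le q hN)) hpN
    have h3 := Nat.le_of_dvd (Nat.gcd_pos_of_pos_left _ hc) (Nat.dvd_gcd h1 h2)
    have h4 := hmax (N + 1)
    have h5 := hpp.two_le
    nlinarith
  · conv_lhs => rw [hc₁]
    exact mul_dvd_mul_right (Nat.gcd_dvd_right _ _) _

/-- Divisors of the `p_n` of bounded index eventually absorb every `p_k`. -/
theorem exists_lengthProd_dvd (hq : ∀ n, 0 < q n)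
    (hp : ∀ p : ℕ, p.Prime → ∀ k, p ∣ q k → ∃ᶠ n in atTop, p ∣ q n) {K : ℕ} {c : ℕ → ℕ}
    (hc : ∀ n, ∃ r ≤ K, lengthProd q n = r * c n) (k : ℕ) : ∃ n, lengthProd q k ∣ c n := by
  set P := lengthProd q k with hP
  have hPpos : 0 < P := lengthProd_pos hq k
  -- The exponent `K + 1` leaves room for the index: `v_p(r) < r ≤ K`, so removing `r` from a
  -- multiple of `P ^ (K + 1)` still leaves `P`.
  obtain ⟨n, c₁, h1, h2, h3⟩ := exists_dvd_lengthProd_mul hp (pow_pos hPpos (K + 1))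
  have hc1 : c₁ = 1 := by
    have h4 : Nat.Coprime c₁ (P ^ (K + 1)) := (coprime_lengthProd h2 k).pow_right _
    exact Nat.Coprime.eq_one_of_dvd h4 h1
  rw [hc1, mul_one] at h3
  obtain ⟨r, hr, he⟩ := hc n
  have hn := lengthProd_pos hq n
  have hr0 : r ≠ 0 := by rintro rfl; simp at he; omega
  have hcn : c n ≠ 0 := by intro h; rw [h] at he; simp at he; omega
  refine ⟨n, (Nat.factorization_prime_le_iff_dvd hPpos.ne' hcn).1 fun p hpp => ?_⟩
  rw [he] at h3
  have h4 := (Nat.factorization_prime_le_iff_dvd (pow_pos hPpos (K + 1)).ne'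
    (mul_ne_zero hr0 hcn)).2 h3 p hpp
  rw [Nat.factorization_mul hr0 hcn, Nat.factorization_pow] at h4
  simp only [Finsupp.smul_apply, Finsupp.add_apply, smul_eq_mul] at h4
  have h5 := Nat.factorization_lt p hr0
  rcases Nat.eq_zero_or_pos (P.factorization p) with h6 | h6
  · omega
  · nlinarith

end LengthProd

/-! ### The odometer as maximal equicontinuous factor. -/

section Equicontinuous

theorem addRight_zpow {Z : Type*} [TopologicalSpace Z] [AddCommGroup Z] [IsTopologicalAddGroup Z]
    (a : Z) (n : ℤ) (z : Z) : (Homeomorph.addRight a ^ n) z = z + n • a := by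
  induction n using Int.induction_on generalizing z with
  | zero => simp
  | succ k ih =>
    rw [← zpow_one_add_homeo, ih, Homeomorph.coe_addRight, add_zsmul, one_zsmul,
      add_comm _ a, ← add_assoc]
  | pred k ih =>
    have h1 : (Homeomorph.addRight a ^ (-1 : ℤ)) z = z - a := by
      apply (Homeomorph.addRight a).injective
      have := zpow_neg_homeo (Homeomorph.addRight a) 1 z
      rw [zpow_one] at this
      rw [this]; simp
    rw [sub_eq_add_neg, zpow_add_homeo, h1, ih, add_zsmul, neg_one_zsmul]; abel

theorem isEquicontinuousSystem_addRight {Z : Type} [TopologicalSpace Z] [AddCommGroup Z]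
    [IsTopologicalAddGroup Z] [CompactSpace Z] [T2Space Z] (a : Z) :
    IsEquicontinuousSystem (Homeomorph.addRight a) := by
  refine ⟨inferInstance, inferInstance, IsTopologicalAddGroup.rightUniformSpace Z, rfl, ?_⟩
  let _ := IsTopologicalAddGroup.rightUniformSpace Z
  have : IsUniformAddGroup Z := isUniformAddGroup_of_addCommGroup
  intro x₀ U hU
  rw [uniformity_eq_comap_nhds_zero] at hU
  obtain ⟨V, hV, hVU⟩ := hU
  have h1 : Tendsto (fun x : Z => x - x₀) (𝓝 x₀) (𝓝 0) := by
    have : Continuous fun x : Z => x - x₀ := by fun_prop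
    simpa using this.tendsto x₀
  filter_upwards [h1 hV] with x hx n
  apply hVU
  simp only [mem_preimage, addRight_zpow, add_sub_add_right_eq_sub]
  exact hx

theorem isClosed_odometer (q : ℕ → ℕ) : IsClosed (odometer q : Set (∀ n, ZMod (lengthProd q n))) := by
  have : (odometer q : Set (∀ n, ZMod (lengthProd q n))) = ⋂ n, {x | ZMod.castHom (lengthProd_dvd q n)
      (ZMod (lengthProd q n)) (x (n + 1)) = x n} := by
    ext x; simp only [mem_iInter]; rfl
  rw [this]
  refine isClosed_iInter fun n => isClosed_eq ?_ (continuous_apply n)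
  exact (continuous_of_discreteTopology (f := ZMod.castHom (lengthProd_dvd q n)
    (ZMod (lengthProd q n)))).comp (continuous_apply (n + 1))

theorem compactSpace_odometer {q : ℕ → ℕ} (hq : ∀ n, 0 < q n) : CompactSpace (odometer q) := by
  have : ∀ n, NeZero (lengthProd q n) := fun n => ⟨(lengthProd_pos hq n).ne'⟩
  exact isCompact_iff_compactSpace.1 (isClosed_odometer q).isCompact

theorem odometer_coe_zsmul (q : ℕ → ℕ) (k : ℤ) (n : ℕ) :
    ((k • odometerOne q : odometer q) : ∀ n, ZMod (lengthProd q n)) n = k := by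
  simp [odometerOne]

variable {X : Type} [TopologicalSpace X]

theorem HasCyclicFactor.of_addRight {T : X ≃ₜ X} {q : ℕ → ℕ} {h : ℕ} {π : X → odometer q × ZMod h}
    (hπ : IsFactorMap T (Homeomorph.addRight ((odometerOne q, 1) : odometer q × ZMod h)) π) :
    HasCyclicFactor T h :=
  ⟨fun x => (π x).2, continuous_snd.comp hπ.1, fun x => congrArg Prod.snd (hπ.2.2 x)⟩

/-- The factor `ℤ/d` factors through the rotation by some `ψ`. The translations by `p_n h` tend to
`0`, so continuity of `ψ` into a discrete space forces `d ∣ p_n h` for some `n`, and coprimality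
leaves `d ∣ h`. -/
theorem HasCyclicFactor.dvd_of_isMaximal [Nonempty X] {T : X ≃ₜ X} {q : ℕ → ℕ} {h d : ℕ}
    (hM : IsMaximalEquicontinuousFactor T
      (Homeomorph.addRight ((odometerOne q, 1) : odometer q × ZMod h)))
    (hd0 : 0 < d) (hd : ∀ n, Nat.Coprime d (q n)) (hT : HasCyclicFactor T d) : d ∣ h := by
  obtain ⟨-, π, hπ, hmax⟩ := hM
  obtain ⟨f, hf, hfT⟩ := hT
  have : NeZero d := ⟨hd0.ne'⟩
  obtain ⟨x⟩ := ‹Nonempty X›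
  obtain ⟨ψ, ⟨hψ, -, hψT⟩, -⟩ := hmax (ZMod d) (Homeomorph.addRight 1) f
    (isEquicontinuousSystem_addRight 1) ⟨hf, fun v => by
      obtain ⟨i, hi⟩ := ZMod.intCast_surjective (v - f x)
      exact ⟨(T ^ i) x, by rw [cyclic_zpow hfT, hi]; ring⟩, hfT⟩
  have hψn : ∀ (k : ℤ) z, ψ (z + k • ((odometerOne q, 1) : odometer q × ZMod h)) = ψ z + k := by
    intro k z
    rw [← addRight_zpow, zpow_semiconj _ (Homeomorph.addRight 1) ψ hψT, addRight_zpow]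
    simp
  have hlim : Tendsto (fun n : ℕ => ((lengthProd q n * h : ℕ) : ℤ) •
      ((odometerOne q, 1) : odometer q × ZMod h)) atTop (𝓝 0) := by
    refine Tendsto.prodMk_nhds ?_ ?_
    · rw [tendsto_subtype_rng, tendsto_pi_nhds]
      intro n
      refine tendsto_const_nhds.congr' ?_
      filter_upwards [eventually_ge_atTop n] with m hm
      refine Eq.symm ((odometer_coe_zsmul q _ n).trans ?_)
      rw [Int.cast_natCast]
      exact (ZMod.natCast_eq_zero_iff _ _).2 ((lengthProd_dvd_of_le q hm).mul_right _)
    · refine tendsto_const_nhds.congr fun m => ?_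
      simp
  have h1 : Tendsto (fun n : ℕ => ψ (0 + ((lengthProd q n * h : ℕ) : ℤ) •
      ((odometerOne q, 1) : odometer q × ZMod h))) atTop (𝓝 (ψ 0)) := by
    simp only [zero_add]
    exact (hψ.tendsto 0).comp hlim
  rw [nhds_discrete, tendsto_pure] at h1
  obtain ⟨n, hn⟩ := h1.exists
  rw [hψn, add_eq_left, Int.cast_natCast, ZMod.natCast_eq_zero_iff] at hn
  exact (coprime_lengthProd hd n).dvd_of_dvd_mul_left hn

/-- The normalised maps to `ℤ/p_n` and the map to `ℤ/h` assemble to `π`, onto by the Chinese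
remainder theorem and compactness. By `hsep`, the universal property reduces to cyclic factors; the
order of each divides some `p_n h`, so each is a function of `π` up to a constant. -/
theorem isMaximalEquicontinuousFactor_odometer [CompactSpace X] [Nonempty X] {T : X ≃ₜ X} (hT : IsMinimalHomeo T)
    {q : ℕ → ℕ} (hq : ∀ n, 0 < q n)
    (hp : ∀ p : ℕ, p.Prime → ∀ k, p ∣ q k → ∃ᶠ n in atTop, p ∣ q n)
    {h : ℕ} (hh0 : 0 < h) (hcop : ∀ n, Nat.Coprime h (q n))
    (hTq : ∀ n, HasCyclicFactor T (lengthProd q n)) (hTh : HasCyclicFactor T h)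
    (hmax : ∀ d, 0 < d → (∀ n, Nat.Coprime d (q n)) → HasCyclicFactor T d → d ∣ h)
    (hsep : ∀ (Y : Type) [TopologicalSpace Y] (R : Y ≃ₜ Y) (ρ : X → Y), IsEquicontinuousSystem R →
      IsFactorMap T R ρ → ∀ x y, ρ x ≠ ρ y →
        ∃ c, 0 < c ∧ ∃ f : X → ZMod c, Continuous f ∧ (∀ x, f (T x) = f x + 1) ∧ f x ≠ f y) :
    IsMaximalEquicontinuousFactor T
      (Homeomorph.addRight ((odometerOne q, 1) : odometer q × ZMod h)) := by
  have : NeZero h := ⟨hh0.ne'⟩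
  have hnz : ∀ n, NeZero (lengthProd q n) := fun n => ⟨(lengthProd_pos hq n).ne'⟩
  have := compactSpace_odometer hq
  refine ⟨isEquicontinuousSystem_addRight _, ?_⟩
  obtain ⟨x₀⟩ := ‹Nonempty X›
  have hTq' : ∀ n, ∃ f : X → ZMod (lengthProd q n), Continuous f ∧ (∀ x, f (T x) = f x + 1) ∧
      f x₀ = 0 := by
    intro n
    obtain ⟨f, hf, hfT⟩ := hTq n
    exact ⟨fun x => f x - f x₀, hf.sub continuous_const, fun x => by simp only [hfT]; ring, sub_self _⟩
  choose f hf hfT hf0 using hTq'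
  obtain ⟨g, hg, hgT⟩ := hTh
  have hcast : ∀ n x, ZMod.castHom (lengthProd_dvd q n) (ZMod (lengthProd q n)) (f (n + 1) x) =
      f n x := by
    intro n x
    have := hT.const (f := fun x => ZMod.castHom (lengthProd_dvd q n) (ZMod (lengthProd q n))
      (f (n + 1) x) - f n x) (((continuous_of_discreteTopology (f := ZMod.castHom (lengthProd_dvd q n)
        (ZMod (lengthProd q n)))).comp (hf (n + 1))).sub (hf n)) (fun x => by
          simp only [hfT, map_add, map_one]; ring) x x₀
    simp only [hf0, map_zero, sub_self] at this
    exact sub_eq_zero.1 this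
  let π : X → odometer q × ZMod h := fun x => (⟨fun n => f n x, fun n => hcast n x⟩, g x)
  have hπc : Continuous π :=
    ((continuous_pi hf).subtype_mk _).prodMk hg
  have hcrt : ∀ n (a : ZMod (lengthProd q n)) (b : ZMod h) (x : X),
      ∃ k : ℤ, f n ((T ^ k) x) = a ∧ g ((T ^ k) x) = b := by
    intro n a b x
    obtain ⟨k, hk⟩ := ZMod.intCast_surjective ((ZMod.chineseRemainder
      (coprime_lengthProd hcop n).symm).symm (a - f n x, b - g x))
    have h1 := congrArg (ZMod.chineseRemainder (coprime_lengthProd hcop n).symm) hk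
    rw [RingEquiv.apply_symm_apply, map_intCast] at h1
    refine ⟨k, ?_, ?_⟩
    · rw [cyclic_zpow (hfT n)]
      have : (k : ZMod (lengthProd q n)) = a - f n x := congrArg Prod.fst h1
      rw [this]; ring
    · rw [cyclic_zpow hgT]
      have : (k : ZMod h) = b - g x := congrArg Prod.snd h1
      rw [this]; ring
  have hπs : Function.Surjective π := by
    rintro ⟨⟨z, hz⟩, w⟩
    have hz' : ∀ n, ZMod.castHom (lengthProd_dvd q n) (ZMod (lengthProd q n)) (z (n + 1)) = z n := hz
    obtain ⟨x, hx⟩ := IsCompact.nonempty_iInter_of_sequence_nonempty_isCompact_isClosed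
      (fun n => {x | f n x = z n ∧ g x = w}) (fun n x hx => ⟨by
        rw [← hcast, hx.1, hz'], hx.2⟩) (fun n => by
          obtain ⟨k, hk⟩ := hcrt n (z n) w x₀
          exact ⟨_, hk⟩)
      (((isClosed_singleton.preimage (hf 0)).inter (isClosed_singleton.preimage hg)).isCompact)
      fun n => (isClosed_singleton.preimage (hf n)).inter (isClosed_singleton.preimage hg)
    rw [mem_iInter] at hx
    exact ⟨x, Prod.ext (Subtype.ext (funext fun n => (hx n).1)) (hx 0).2⟩
  have hπT : Function.Semiconj π T
      (Homeomorph.addRight ((odometerOne q, 1) : odometer q × ZMod h)) := fun x =>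
    Prod.ext (Subtype.ext (funext fun n => hfT n x)) (hgT x)
  refine ⟨π, ⟨hπc, hπs, hπT⟩, fun Y _ R ρ hR hρ => ?_⟩
  have hT2 : T2Space Y := hR.2.1
  have hfac : ∀ x y, π x = π y → ρ x = ρ y := by
    intro x y hxy
    by_contra hne
    obtain ⟨c, hc0, F, hF, hFT, hFne⟩ := hsep Y R ρ hR hρ x y hne
    obtain ⟨n, c₁, hc₁, hc₁q, hcd⟩ := exists_dvd_lengthProd_mul hp hc0
    have h1 : c₁ ∣ h := hmax c₁ (Nat.pos_of_dvd_of_pos hc₁ hc0) hc₁q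
      (HasCyclicFactor.of_dvd ⟨F, hF, hFT⟩ hc₁)
    have hch : c ∣ lengthProd q n * h := hcd.trans (mul_dvd_mul_left _ h1)
    let e := ZMod.chineseRemainder (coprime_lengthProd hcop n).symm
    let G : X → ZMod c := fun x => ZMod.castHom hch (ZMod c) (e.symm (f n x, g x))
    have hconst := hT.const (f := fun x => F x - G x) (hF.sub
      ((continuous_of_discreteTopology (f := fun v => ZMod.castHom hch (ZMod c) (e.symm v))).comp
        ((hf n).prodMk hg))) (fun x => by
          have h2 : G (T x) = G x + 1 := by
            have : ((f n (T x), g (T x)) : ZMod (lengthProd q n) × ZMod h) = (f n x, g x) + 1 :=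
              Prod.ext (hfT n x) (hgT x)
            simp only [G, this, map_add, map_one]
          rw [h2, hFT]; ring) x y
    have hGG : G x = G y := by
      have h3 : f n x = f n y := congrFun (congrArg (fun z => (z.1 : ∀ n, ZMod (lengthProd q n))) hxy) n
      have h4 : g x = g y := congrArg Prod.snd hxy
      simp only [G, h3, h4]
    simp only [hGG] at hconst
    exact hFne (sub_left_injective hconst)
  have hquot : IsQuotientMap π := hπc.isClosedMap.isQuotientMap hπc hπs
  have hψ : ∀ x, ρ (Function.surjInv hπs (π x)) = ρ x := fun x =>
    hfac _ _ (Function.surjInv_eq hπs (π x))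
  refine ⟨fun z => ρ (Function.surjInv hπs z), ⟨?_, ?_, ?_⟩, funext hψ⟩
  · rw [hquot.continuous_iff]
    exact hρ.1.congr fun x => (hψ x).symm
  · intro v
    obtain ⟨x, rfl⟩ := hρ.2.1 v
    exact ⟨π x, hψ x⟩
  · intro z
    obtain ⟨x, rfl⟩ := hπs z
    dsimp only
    rw [← hπT x, hψ, hψ, hρ.2.2 x]

end Equicontinuous

/-! ### Shifts and substitutions on bi-infinite words. -/

/-- The shift by `k` places. -/
def shiftBy {α : Type} (k : ℤ) (x : ℤ → α) : ℤ → α := fun m => x (m + k)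

theorem shiftBy_one {α : Type} (x : ℤ → α) : shiftBy 1 x = leftShift x := rfl

theorem shiftBy_shiftBy {α : Type} (i j : ℤ) (x : ℤ → α) :
    shiftBy i (shiftBy j x) = shiftBy (i + j) x := by
  funext m; simp [shiftBy, add_assoc]

theorem shiftBy_zero {α : Type} (x : ℤ → α) : shiftBy 0 x = x := by
  funext m; simp [shiftBy]

theorem leftShift_iterate {α : Type} (k : ℕ) (x : ℤ → α) : leftShift^[k] x = shiftBy k x := by
  induction k with
  | zero => simp [shiftBy_zero]
  | succ k ih =>
    rw [Function.iterate_succ_apply', ih, ← shiftBy_one, shiftBy_shiftBy]; push_cast; rw [add_comm]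

theorem ofFn_window_infix {α : Type} (x : ℤ → α) (i : ℤ) (r l s : ℕ) :
    List.ofFn (fun j : Fin l => x (i + r + (j : ℕ))) <:+:
      List.ofFn (fun j : Fin (r + l + s) => x (i + (j : ℕ))) := by
  have : List.ofFn (fun j : Fin l => x (i + r + (j : ℕ))) =
      ((List.ofFn (fun j : Fin (r + l + s) => x (i + (j : ℕ)))).drop r).take l := by
    apply List.ext_getElem
    · simp; omega
    · intro m h1 h2
      simp [add_assoc]
  rw [this]
  exact (List.take_prefix _ _).isInfix.trans (List.drop_suffix _ _).isInfix

theorem List.IsInfix.flatMap_congr {α β : Type} {l l' : List α} (h : l <:+: l') (f : α → List β) :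
    l.flatMap f <:+: l'.flatMap f := by
  obtain ⟨s, t, rfl⟩ := h
  exact ⟨s.flatMap f, t.flatMap f, by simp⟩

namespace DirectiveSeq

variable (D : DirectiveSeq)

theorem ofFn_θ_cast {m m' : ℕ} (h : m = m') (a : D.A (m + 1)) :
    List.ofFn (D.θ m' (cast (by rw [h]) a)) =
      (List.ofFn (D.θ m a)).map (cast (by rw [h])) := by
  subst h
  simp
  rfl

theorem supertile_flatMap (n k : ℕ) (a : D.A (n + 1 + k)) :
    (D.supertile (n + 1) k a).flatMap (fun b => List.ofFn (D.θ n b)) =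
      D.supertile n (k + 1) (cast (by rw [Nat.add_right_comm, Nat.add_assoc]) a) := by
  induction k with
  | zero =>
    simp only [supertile, List.flatMap_singleton]
    exact (List.flatMap_singleton' _).symm
  | succ k ih =>
    rw [supertile, List.flatMap_assoc, supertile]
    simp only [ih]
    have := D.ofFn_θ_cast (m := n + 1 + k) (m' := n + (k + 1)) (by omega) a
    rw [this, List.flatMap_map]

variable {D}

theorem subst_apply {n : ℕ} (x : ℤ → D.A (n + 1)) (k : ℤ) (s : Fin (D.q n)) :
    D.subst n x (k * D.q n + (s : ℕ)) = D.θ n (x k) s := by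
  have hq : (0 : ℤ) < D.q n := by exact_mod_cast D.q_pos n
  have h1 : ((s : ℕ) : ℤ) < D.q n := by exact_mod_cast s.2
  have h2 : (k * D.q n + (s : ℕ)) / (D.q n : ℤ) = k := by
    rw [add_comm, Int.add_mul_ediv_right _ _ hq.ne', Int.ediv_eq_zero_of_lt (by positivity) h1,
      zero_add]
  have h3 : (k * D.q n + (s : ℕ)) % (D.q n : ℤ) = (s : ℕ) := by
    rw [add_comm, Int.add_mul_emod_self_right, Int.emod_eq_of_lt (by positivity) h1]
  unfold subst
  congr 1
  · rw [h2]
  · apply Fin.ext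
    simp [h3]

theorem exists_div_mod {q : ℕ} (hq : 0 < q) (m : ℤ) : ∃ (k : ℤ) (s : Fin q), m = k * q + (s : ℕ) := by
  have hq' : (0 : ℤ) < q := by exact_mod_cast hq
  have h1 := Int.emod_nonneg m hq'.ne'
  have h2 := Int.emod_lt_of_pos m hq'
  refine ⟨m / q, ⟨(m % q).toNat, by omega⟩, ?_⟩
  simp only [Int.toNat_of_nonneg h1]
  rw [mul_comm, Int.mul_ediv_add_emod]

theorem subst_shiftBy {n : ℕ} (k : ℤ) (x : ℤ → D.A (n + 1)) :
    D.subst n (shiftBy k x) = shiftBy (k * D.q n) (D.subst n x) := by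
  funext m
  obtain ⟨i, s, rfl⟩ := exists_div_mod (D.q_pos n) m
  rw [subst_apply, shiftBy, shiftBy, add_right_comm, ← add_mul, subst_apply]

theorem subst_injective {n : ℕ} (h : Function.Injective (D.θ n)) : Function.Injective (D.subst n) := by
  intro x y hxy
  funext k
  apply h
  funext s
  rw [← subst_apply, ← subst_apply, hxy]

theorem continuous_subst (n : ℕ) : Continuous (D.subst n) := by
  refine continuous_pi fun m => ?_
  obtain ⟨k, s, rfl⟩ := exists_div_mod (D.q_pos n) m
  simp only [subst_apply]
  exact (continuous_of_discreteTopology (f := fun a => D.θ n a s)).comp (continuous_apply k)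

theorem subst_mem {n : ℕ} {x : ℤ → D.A (n + 1)} (hx : x ∈ D.X (n + 1)) : D.subst n x ∈ D.X n := by
  intro i l
  obtain ⟨a, r, rfl⟩ := exists_div_mod (D.q_pos n) i
  -- `l + 1` letters suffice: the window starts at offset `r < q n` in the first block.
  obtain ⟨k, -, c, hc⟩ := hx a (l + 1)
  have h1 := hc.flatMap_congr (fun b => List.ofFn (D.θ n b))
  rw [supertile_flatMap] at h1
  refine ⟨k + 1, by omega, _, List.IsInfix.trans ?_ h1⟩
  have h2 : (List.ofFn fun j : Fin (l + 1) => x (a + (j : ℕ))).flatMap (fun b => List.ofFn (D.θ n b)) =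
      List.ofFn fun t : Fin ((l + 1) * D.q n) => D.subst n x (a * D.q n + (t : ℕ)) := by
    rw [List.ofFn_mul, List.flatMap, List.map_ofFn]
    congr 2
    funext j
    simp only [Function.comp]
    congr 1
    funext s
    rw [← subst_apply]
    congr 1
    push_cast
    ring
  rw [h2]
  have h3 : ∃ s, (l + 1) * D.q n = r + l + s := by
    have := D.q_pos n
    have := r.2
    refine Nat.exists_eq_add_of_le ?_
    nlinarith
  obtain ⟨s, hs⟩ := h3
  rw [hs]
  exact ofFn_window_infix _ _ _ _ _

variable (D) in
theorem isClosed_X (n : ℕ) : IsClosed (D.X n) := by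
  have : D.X n = ⋂ (i : ℤ) (l : ℕ), (fun (x : ℤ → D.A n) (j : Fin l) => x (i + (j : ℕ))) ⁻¹'
      {w | List.ofFn w ∈ D.preLanguage n} := by
    ext x; simp only [mem_iInter]; rfl
  rw [this]
  refine isClosed_iInter fun i => isClosed_iInter fun l => (isClosed_discrete _).preimage ?_
  fun_prop

instance (n : ℕ) : CompactSpace (D.X n) := isCompact_iff_compactSpace.1 (D.isClosed_X n).isCompact

theorem shiftBy_mem {n : ℕ} {x : ℤ → D.A n} (hx : x ∈ D.X n) (k : ℤ) : shiftBy k x ∈ D.X n := by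
  intro i l
  have := hx (i + k) l
  convert this using 3 with j
  simp only [shiftBy]
  congr 1
  ring

theorem continuous_shiftBy {n : ℕ} (k : ℤ) : Continuous (shiftBy k : (ℤ → D.A n) → ℤ → D.A n) :=
  continuous_pi fun m => continuous_apply (m + k)

variable (D) in
/-- The shift as a homeomorphism of `X^{(n)}`. -/
def shiftHomeo (n : ℕ) : D.X n ≃ₜ D.X n where
  toFun := D.shiftX n
  invFun x := ⟨shiftBy (-1) x.1, shiftBy_mem x.2 _⟩
  left_inv x := Subtype.ext ((shiftBy_shiftBy (-1) 1 x.1).trans (shiftBy_zero _))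
  right_inv x := Subtype.ext ((shiftBy_shiftBy 1 (-1) x.1).trans (shiftBy_zero _))
  continuous_toFun := ((continuous_shiftBy 1).comp continuous_subtype_val).subtype_mk _
  continuous_invFun := ((continuous_shiftBy (-1)).comp continuous_subtype_val).subtype_mk _

theorem shiftHomeo_zpow {n : ℕ} (k : ℤ) (x : D.X n) :
    ((D.shiftHomeo n ^ k) x : ℤ → D.A n) = shiftBy k x := by
  induction k using Int.induction_on generalizing x with
  | zero => rw [shiftBy_zero]; rfl
  | succ k ih =>
    rw [← zpow_one_add_homeo, ih]
    exact shiftBy_shiftBy k 1 x.1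
  | pred k ih =>
    rw [sub_eq_add_neg, zpow_add_homeo, ih, zpow_neg_one]
    exact shiftBy_shiftBy (-k) (-1) x.1

theorem isMinimalHomeo_shiftHomeo {n : ℕ} (h : IsMinimalShift (D.X n)) :
    IsMinimalHomeo (D.shiftHomeo n) := by
  intro C hC hinv
  have hmem : ∀ x, D.shiftHomeo n x ∈ C ↔ x ∈ C := fun x => by
    conv_rhs => rw [← hinv]
    rfl
  rcases h.2 (Subtype.val '' C) (by rintro _ ⟨x, -, rfl⟩; exact x.2)
    ((D.isClosed_X n).isClosedEmbedding_subtypeVal.isClosedMap C hC) (by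
      ext y
      constructor
      · rintro ⟨_, ⟨x, hx, rfl⟩, rfl⟩
        exact ⟨_, (hmem x).2 hx, rfl⟩
      · rintro ⟨x, hx, rfl⟩
        refine ⟨_, ⟨(D.shiftHomeo n).symm x, ?_, rfl⟩, ?_⟩
        · rw [← hmem, Homeomorph.apply_symm_apply]; exact hx
        · exact congrArg Subtype.val ((D.shiftHomeo n).apply_symm_apply x)) with h | h
  · exact Or.inl (image_eq_empty.1 h)
  · refine Or.inr (eq_univ_of_forall fun x => ?_)
    obtain ⟨y, hy, hyx⟩ := (h.symm ▸ x.2 : x.1 ∈ Subtype.val '' C)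
    rwa [← Subtype.ext hyx]

variable (D) in
/-- The action of `θ^{[0, n)}` on bi-infinite sequences. -/
def substIter : (n : ℕ) → (ℤ → D.A n) → ℤ → D.A 0
  | 0, x => x
  | n + 1, x => substIter n (D.subst n x)

theorem substIter_mem {n : ℕ} {x : ℤ → D.A n} (hx : x ∈ D.X n) : D.substIter n x ∈ D.X 0 := by
  induction n with
  | zero => exact hx
  | succ n ih => exact ih (subst_mem hx)

theorem continuous_substIter (n : ℕ) : Continuous (D.substIter n) := by
  induction n with
  | zero => exact continuous_id
  | succ n ih => exact ih.comp (continuous_subst n)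

theorem substIter_shiftBy {n : ℕ} (k : ℤ) (x : ℤ → D.A n) :
    D.substIter n (shiftBy k x) = shiftBy (k * lengthProd D.q n) (D.substIter n x) := by
  induction n generalizing k with
  | zero => simp [substIter, lengthProd]
  | succ n ih =>
    rw [substIter, subst_shiftBy, ih, lengthProd_succ, substIter]
    congr 1
    push_cast
    ring

theorem substIter_injective (h : ∀ n, Function.Injective (D.θ n)) (n : ℕ) :
    Function.Injective (D.substIter n) := by
  induction n with
  | zero => exact fun _ _ h => h
  | succ n ih => exact ih.comp (subst_injective (h n))

/-- The letter at position `k` determines the `k`-th block of length `p_n` of the image. -/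
theorem substIter_apply_eq {n : ℕ} {x y : ℤ → D.A n} {k l : ℤ} (h : x k = y l) {t : ℕ}
    (ht : t < lengthProd D.q n) : D.substIter n x (k * lengthProd D.q n + t) =
      D.substIter n y (l * lengthProd D.q n + t) := by
  induction n generalizing k l t with
  | zero =>
    have : t = 0 := by simpa [lengthProd] using ht
    subst this
    simpa [lengthProd, substIter] using h
  | succ n ih =>
    have hp := lengthProd_pos D.q_pos n
    rw [lengthProd_succ] at ht
    have hs : t / lengthProd D.q n < D.q n := Nat.div_lt_of_lt_mul ht
    have h1 : D.subst n x (k * D.q n + (t / lengthProd D.q n : ℕ)) =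
        D.subst n y (l * D.q n + (t / lengthProd D.q n : ℕ)) := by
      rw [subst_apply x k ⟨_, hs⟩, subst_apply y l ⟨_, hs⟩, h]
    have h2 := ih h1 (Nat.mod_lt t hp)
    have e : ∀ k : ℤ, (k * D.q n + (t / lengthProd D.q n : ℕ)) * lengthProd D.q n +
        (t % lengthProd D.q n : ℕ) = k * lengthProd D.q (n + 1) + t := by
      intro k
      have h3 : ((t / lengthProd D.q n : ℕ) : ℤ) * lengthProd D.q n + (t % lengthProd D.q n : ℕ) = t := by
        exact_mod_cast Nat.div_add_mod' t (lengthProd D.q n)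
      rw [lengthProd_succ]
      push_cast at h3 ⊢
      linear_combination h3
    rw [e, e] at h2
    exact h2

/-- Neighbourhoods of the diagonal of a subshift contain all pairs that agree on a large window. -/
theorem exists_window (U : Set (D.X 0 × D.X 0)) (hU : IsOpen U) (hdiag : ∀ x, (x, x) ∈ U) :
    ∃ r : ℕ, ∀ x y : D.X 0, (∀ m : ℤ, |m| ≤ r → x.1 m = y.1 m) → (x, y) ∈ U := by
  by_contra! hcon
  let C : ℕ → Set (D.X 0 × D.X 0) := fun r =>
    {p | ∀ m : ℤ, |m| ≤ r → p.1.1 m = p.2.1 m} ∩ Uᶜ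
  have hC : ∀ r, IsClosed (C r) := by
    intro r
    refine IsClosed.inter ?_ hU.isClosed_compl
    have : {p : D.X 0 × D.X 0 | ∀ m : ℤ, |m| ≤ r → p.1.1 m = p.2.1 m} =
        ⋂ (m : ℤ) (_ : |m| ≤ r), {p | p.1.1 m = p.2.1 m} := by ext p; simp
    rw [this]
    refine isClosed_iInter fun m => isClosed_iInter fun _ => isClosed_eq ?_ ?_
    · exact (continuous_apply m).comp (continuous_subtype_val.comp continuous_fst)
    · exact (continuous_apply m).comp (continuous_subtype_val.comp continuous_snd)
  obtain ⟨p, hp⟩ := IsCompact.nonempty_iInter_of_sequence_nonempty_isCompact_isClosed C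
    (fun r p hp => ⟨fun m hm => hp.1 m (hm.trans (by push_cast; linarith)), hp.2⟩)
    (fun r => by
      obtain ⟨x, y, h1, h2⟩ := hcon r
      exact ⟨(x, y), h1, h2⟩) (hC 0).isCompact hC
  rw [mem_iInter] at hp
  have : p.1 = p.2 := Subtype.ext (funext fun m => (hp m.natAbs).1 m (by simp))
  have h2 := (hp 0).2
  exact h2 (by rw [show p = (p.1, p.1) from Prod.ext rfl this.symm]; exact hdiag _)

end DirectiveSeq

/-! ### Cyclic factors of the shift and existence of the height. -/

/-- A bi-infinite sequence with at most `r` words of length `r` is periodic (Morse–Hedlund). -/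
theorem exists_period_of_colouring {β γ : Type*} [Finite β] (b : ℤ → γ) (a : ℤ → β) (r : ℕ)
    (hr : Nat.card β ≤ r) (h : ∀ i j, a i = a j → ∀ s : ℕ, s < r → b (i + s) = b (j + s)) :
    ∃ P : ℕ, 0 < P ∧ ∀ i, b (i + P) = b i := by
  classical
  let E : ℕ → Setoid ℤ := fun l => Setoid.ker fun i (s : Fin l) => b (i + (s : ℕ))
  have hE : ∀ l i j, E l i j ↔ ∀ s < l, b (i + (s : ℕ)) = b (j + (s : ℕ)) := fun l i j =>
    ⟨fun h s hs => congrFun h ⟨s, hs⟩, fun h => funext fun s => h s s.2⟩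
  have hinj : ∀ l ≤ r, Function.Injective fun c : Quotient (E l) => a c.out := by
    intro l hl c c' hcc
    rw [← Quotient.out_equiv_out]
    exact (hE _ _ _).2 fun s hs => h _ _ hcc s (hs.trans_le hl)
  have hfin : ∀ l ≤ r, Finite (Quotient (E l)) := fun l hl => Finite.of_injective _ (hinj l hl)
  -- Otherwise the number of words of length `l` increases strictly up to `l = r`, exceeding the
  -- number of colours. Hence some length `l` exists at which a word determines its right extension.
  obtain ⟨l, hl, hstep⟩ : ∃ l < r, ∀ i j, E l i j → E (l + 1) i j := by
    by_contra! hcon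
    have hcard : ∀ l ≤ r, l + 1 ≤ Nat.card (Quotient (E l)) := by
      intro l
      induction l with
      | zero =>
        intro hl
        have := hfin 0 hl
        have : Nonempty (Quotient (E 0)) := ⟨⟦0⟧⟩
        exact Nat.card_pos
      | succ l ih =>
        intro hl
        obtain ⟨i, j, hij, hnij⟩ := hcon l hl
        have := hfin l (by omega)
        have := hfin (l + 1) hl
        have := Fintype.ofFinite (Quotient (E l))
        have := Fintype.ofFinite (Quotient (E (l + 1)))
        let p : Quotient (E (l + 1)) → Quotient (E l) :=
          Quotient.map id fun i j hij => (hE _ _ _).2 fun s hs => (hE _ _ _).1 hij s (by omega)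
        have hlt := Fintype.card_lt_of_surjective_not_injective p
          (fun c => by
            induction c using Quotient.inductionOn with
            | h i => exact ⟨⟦i⟧, rfl⟩)
          (fun hp => hnij (Quotient.exact (hp (a₁ := ⟦i⟧) (a₂ := ⟦j⟧) (Quotient.sound hij))))
        have := ih (by omega)
        rw [Nat.card_eq_fintype_card] at this ⊢
        omega
    have h1 := hcard r le_rfl
    have h2 := Nat.card_le_card_of_injective _ (hinj r le_rfl)
    omega
  have hfwd : ∀ (t : ℕ) (i j : ℤ), E l i j → E l (i + t) (j + t) := by
    intro t
    induction t with
    | zero => intro i j hij; simpa using hij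
    | succ t ih =>
      intro i j hij
      have h1 := (hE _ _ _).1 (hstep _ _ (ih i j hij))
      refine (hE _ _ _).2 fun s hs => ?_
      have h2 := h1 (s + 1) (by omega)
      push_cast at h2 ⊢
      convert h2 using 2 <;> ring
  -- The period found to the right of `m` depends on `m` but is at most `r`, so `r!` serves for all.
  -- The repeated colour is sought in `[m - r, m]` so that rightward propagation covers `m`.
  refine ⟨r.factorial, Nat.factorial_pos _, fun m => ?_⟩
  have := Fintype.ofFinite β
  obtain ⟨s, s', hss, has⟩ := Fintype.exists_ne_map_eq_of_card_lt
    (fun s : Fin (r + 1) => a (m - r + (s : ℕ))) (by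
      rw [Fintype.card_fin, ← Nat.card_eq_fintype_card]; omega)
  wlog hlt : s < s' generalizing s s'
  · exact this s' s hss.symm has.symm (lt_of_le_of_ne (not_lt.1 hlt) hss.symm)
  have h0 : E l (m - r + (s : ℕ)) (m - r + (s' : ℕ)) :=
    (hE _ _ _).2 fun t ht => h _ _ has t (ht.trans hl)
  have hper : ∀ t : ℕ, b (m + t + ((s' : ℕ) - (s : ℕ) : ℕ)) = b (m + t) := by
    intro t
    have h1 := (hE _ _ _).1 (hstep _ _ (hfwd (t + (r - s)) _ _ h0)) 0 (by omega)
    have hs := s.2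
    have hs' := s'.2
    have e1 : m - r + (s : ℕ) + ((t + (r - s) : ℕ) : ℤ) + ((0 : ℕ) : ℤ) = m + t := by omega
    have e2 : m - r + (s' : ℕ) + ((t + (r - s) : ℕ) : ℤ) + ((0 : ℕ) : ℤ) =
        m + t + ((s' : ℕ) - (s : ℕ) : ℕ) := by
      have : (s : ℕ) < s' := hlt
      omega
    rw [e1, e2] at h1
    exact h1.symm
  set d := (s' : ℕ) - (s : ℕ) with hd
  have hmul : ∀ k : ℕ, b (m + (k * d : ℕ)) = b m := by
    intro k
    induction k with
    | zero => simp
    | succ k ih =>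
      rw [← ih, ← hper (k * d)]
      congr 1
      push_cast
      ring
  have hdpos : 0 < d := by
    have : (s : ℕ) < s' := hlt
    omega
  obtain ⟨k, hk⟩ := Nat.dvd_factorial hdpos (show d ≤ r by have := s'.2; omega)
  rw [hk, mul_comm]
  exact hmul k

namespace DirectiveSeq

variable {D : DirectiveSeq}

/-- The image of a compact set of level-`n` points is closed, so limits of shifts by multiples of
`p_n m` can still be desubstituted. -/
theorem closure_zpow_subset {n : ℕ} {m : ℕ} {y : ℤ → D.A n} (hy : y ∈ D.X n) {x : D.X 0}
    (hx : x.1 = D.substIter n y) {z : D.X 0}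
    (hz : z ∈ closure (range fun j : ℤ => (D.shiftHomeo 0 ^ (((lengthProd D.q n * m : ℕ) : ℤ) * j)) x)) :
    ∃ w ∈ D.X n ∩ closure (range fun j : ℤ => shiftBy ((m : ℤ) * j) y), D.substIter n w = z.1 := by
  have hcl : IsClosed (D.substIter n ''
      (D.X n ∩ closure (range fun j : ℤ => shiftBy ((m : ℤ) * j) y))) :=
    (((D.isClosed_X n).inter isClosed_closure).isCompact.image (continuous_substIter n)).isClosed
  refine closure_minimal (t := Subtype.val ⁻¹' (D.substIter n ''
      (D.X n ∩ closure (range fun j : ℤ => shiftBy ((m : ℤ) * j) y)))) ?_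
    (hcl.preimage continuous_subtype_val) hz
  rintro _ ⟨j, rfl⟩
  refine ⟨shiftBy ((m : ℤ) * j) y, ⟨shiftBy_mem hy _, subset_closure ⟨j, rfl⟩⟩, ?_⟩
  rw [substIter_shiftBy, shiftHomeo_zpow, hx]
  congr 1
  push_cast
  ring

/-- The addresses in the odometer are continuous functions on `X^{(0)}`. -/
theorem hasCyclicFactor_lengthProd (hmin : IsMinimalHomeo (D.shiftHomeo 0))
    (hne : ∀ n, (D.X n).Nonempty) {K : ℕ} (hK : ∀ n, Nat.card (D.A n) ≤ K)
    (haper : ∀ x ∈ D.X 0, ∀ k : ℕ, 1 ≤ k → leftShift^[k] x ≠ x)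
    (hp : ∀ p : ℕ, p.Prime → ∀ k, p ∣ D.q k → ∃ᶠ n in atTop, p ∣ D.q n) (k : ℕ) :
    HasCyclicFactor (D.shiftHomeo 0) (lengthProd D.q k) := by
  choose c hcd f hf hfT hcl using fun n =>
    exists_cyclic_decomposition hmin (lengthProd_pos D.q_pos n)
  suffices h : ∀ n, ∃ r ≤ K, lengthProd D.q n = r * c n by
    obtain ⟨n, hn⟩ := exists_lengthProd_dvd D.q_pos hp h k
    exact HasCyclicFactor.of_dvd ⟨f n, hf n, hfT n⟩ hn
  intro n
  obtain ⟨r, hr⟩ := hcd n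
  refine ⟨r, ?_, by rw [hr, mul_comm]⟩
  by_contra! hrK
  obtain ⟨y, hy⟩ := hne n
  let x : D.X 0 := ⟨D.substIter n y, substIter_mem hy⟩
  -- Shifts by multiples of `c n` stay in one component of `T ^ p_n`, so they too have a
  -- desubstitution starting at the origin, whose letter at `0` determines `r` blocks of length `c
  -- n`.
  have hw : ∀ i : ℤ, ∃ w : ℤ → D.A n, D.substIter n w = shiftBy (i * c n) x.1 := by
    intro i
    have h1 : f n x = f n ((D.shiftHomeo 0 ^ (i * c n)) x) := by
      rw [cyclic_zpow (hfT n)]; simp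
    have h2 := hcl n _ _ h1
    obtain ⟨w, -, hw⟩ := closure_zpow_subset (m := 1) hy (x := x) rfl (by rwa [mul_one])
    exact ⟨w, by rw [hw, shiftHomeo_zpow]⟩
  choose w hw using hw
  have hcpos : 0 < c n := Nat.pos_of_dvd_of_pos (hcd n) (lengthProd_pos D.q_pos n)
  obtain ⟨P, hP, hper⟩ := exists_period_of_colouring
    (fun (i : ℤ) (t : Fin (c n)) => x.1 (i * c n + (t : ℕ))) (fun i => w i 0) r
    ((hK n).trans hrK.le) (by
      intro i j hij s hs
      funext t
      have ht : (t : ℕ) + s * c n < lengthProd D.q n := by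
        have := t.2
        rw [hr]
        nlinarith
      have h1 := substIter_apply_eq (x := w i) (y := w j) (k := 0) (l := 0) hij ht
      rw [hw, hw, shiftBy, shiftBy] at h1
      convert h1 using 2 <;> push_cast <;> ring)
  refine haper x.1 x.2 (P * c n) (Nat.mul_pos hP hcpos) ?_
  rw [leftShift_iterate]
  funext m
  obtain ⟨i, t, rfl⟩ := exists_div_mod hcpos m
  refine Eq.trans (congrArg x.1 ?_) (congrFun (hper i) t)
  push_cast
  ring

/-- At high levels, occurrences of the same letter give points of `X^{(0)}` that are close. -/
theorem exists_level_close (h1 : ∃ᶠ n in atTop, 1 < D.q n) (U : Set (D.X 0 × D.X 0)) (hU : IsOpen U)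
    (hdiag : ∀ x, (x, x) ∈ U) :
    ∃ (n₀ : ℕ) (s : ℤ), ∀ n, n₀ ≤ n → ∀ (y : ℤ → D.A n) (x : D.X 0), x.1 = D.substIter n y →
      ∀ i j, y i = y j → ((D.shiftHomeo 0 ^ (i * lengthProd D.q n + s)) x,
        (D.shiftHomeo 0 ^ (j * lengthProd D.q n + s)) x) ∈ U := by
  obtain ⟨r, hr⟩ := exists_window U hU hdiag
  -- A block of length at least `2r + 1` contains the window of radius `r` about its offset `r`,
  -- which is the shift `s`.
  obtain ⟨n₀, hn₀⟩ := le_lengthProd D.q_pos h1 (2 * r + 1)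
  refine ⟨n₀, r, fun n hn y x hx i j hij => hr _ _ fun m hm => ?_⟩
  have h2 := hn₀ n hn
  rw [abs_le] at hm
  rw [shiftHomeo_zpow, shiftHomeo_zpow, shiftBy, shiftBy, hx]
  have h3 := substIter_apply_eq hij (t := (m + r).toNat) (by omega)
  rw [Int.toNat_of_nonneg (by omega)] at h3
  convert h3 using 2 <;> ring

/-- A continuous map to `ZMod d` sees a finite window, so at high levels equal letters at `i` and
`j` force `d ∣ (j - i) p_n`, and `d` is coprime to `p_n`. -/
theorem exists_level_dvd_sub (h1 : ∃ᶠ n in atTop, 1 < D.q n) {d : ℕ}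
    (hd : ∀ n, Nat.Coprime d (D.q n)) (hf : HasCyclicFactor (D.shiftHomeo 0) d) :
    ∃ n₀ : ℕ, ∀ n, n₀ ≤ n → ∀ y ∈ D.X n, ∀ i j : ℤ, y i = y j → (d : ℤ) ∣ j - i := by
  obtain ⟨f, hfc, hfT⟩ := hf
  obtain ⟨n₀, s, hs⟩ := exists_level_close h1 {p | f p.1 = f p.2}
    ((isOpen_discrete {p : ZMod d × ZMod d | p.1 = p.2}).preimage
      ((hfc.comp continuous_fst).prodMk (hfc.comp continuous_snd))) fun _ => rfl
  refine ⟨n₀, fun n hn y hy i j hij => ?_⟩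
  have h2 := hs n hn y ⟨_, substIter_mem hy⟩ rfl i j hij
  simp only [mem_ofPred_eq, cyclic_zpow hfT, add_right_inj] at h2
  rw [ZMod.intCast_eq_intCast_iff_dvd_sub] at h2
  have h3 : (d : ℤ) ∣ (j - i) * lengthProd D.q n := by
    convert h2 using 1; ring
  refine IsCoprime.dvd_of_dvd_mul_right ?_ h3
  exact Nat.isCoprime_iff_coprime.2 (coprime_lengthProd hd n)

theorem le_of_hasCyclicFactor (h1 : ∃ᶠ n in atTop, 1 < D.q n) (hne : ∀ n, (D.X n).Nonempty)
    {K : ℕ} (hK : ∀ n, Nat.card (D.A n) ≤ K) {d : ℕ}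
    (hd : ∀ n, Nat.Coprime d (D.q n)) (hf : HasCyclicFactor (D.shiftHomeo 0) d) : d ≤ K := by
  obtain ⟨n, hn⟩ := exists_level_dvd_sub h1 hd hf
  obtain ⟨y, hy⟩ := hne n
  have := Fintype.ofFinite (D.A n)
  obtain ⟨s, s', hss, hys⟩ := Fintype.exists_ne_map_eq_of_card_lt
    (fun s : Fin (K + 1) => y (s : ℕ)) (by
      have := hK n
      rw [Fintype.card_fin, ← Nat.card_eq_fintype_card]; omega)
  have h2 := hn n le_rfl y hy _ _ hys
  have h3 : ((s' : ℕ) : ℤ) - (s : ℕ) ≠ 0 := by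
    intro h; exact hss (Fin.ext (by omega))
  have h4 := Int.le_of_dvd (abs_pos.2 h3) ((dvd_abs _ _).2 h2)
  have h5 : |((s' : ℕ) : ℤ) - (s : ℕ)| ≤ K := by
    have := s.2
    have := s'.2
    rw [abs_le]; omega
  exact_mod_cast h4.trans h5

/-- Points which are separated by an equicontinuous factor are separated by a finite one. -/
theorem exists_cyclic_separating (h1 : ∃ᶠ n in atTop, 1 < D.q n)
    (hmin : IsMinimalHomeo (D.shiftHomeo 0)) (hne : ∀ n, (D.X n).Nonempty)
    {K : ℕ} (hK : ∀ n, Nat.card (D.A n) ≤ K)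
    (Y : Type) [t : TopologicalSpace Y] (R : Y ≃ₜ Y) (ρ : D.X 0 → Y) (hR : IsEquicontinuousSystem R)
    (hρ : IsFactorMap (D.shiftHomeo 0) R ρ) (x y : D.X 0) (hxy : ρ x ≠ ρ y) :
    ∃ c, 0 < c ∧ ∃ f : D.X 0 → ZMod c, Continuous f ∧ (∀ x, f (D.shiftHomeo 0 x) = f x + 1) ∧
      f x ≠ f y := by
  obtain ⟨hc, hT2, u, rfl, heq⟩ := hR
  set T := D.shiftHomeo 0 with hT
  obtain ⟨g, hg0, hg1, -⟩ := exists_continuous_zero_one_of_isClosed (isClosed_singleton (x := ρ x))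
    (isClosed_singleton (x := ρ y)) (disjoint_singleton.2 hxy)
  have hgu : UniformContinuous g := CompactSpace.uniformContinuous_of_continuous g.continuous
  have hRu := CompactSpace.uniformEquicontinuous_of_equicontinuous heq
  have hρT : ∀ (k : ℤ) z, ρ ((T ^ k) z) = (R ^ k) (ρ z) := zpow_semiconj T R ρ hρ.2.2
  let G : D.X 0 → ℝ := fun z => g (ρ z)
  have hG : Continuous G := g.continuous.comp hρ.1
  have hGx : G x = 0 := hg0 rfl
  have hGy : G y = 1 := hg1 rfl
  -- Chosen so that `2 * K * δ < 1`, the gap between the values of `G` at `x` and `y`.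
  let δ : ℝ := 1 / (2 * K + 1)
  have hδ : 0 < δ := by positivity
  have hV : {p : Y × Y | ∀ k : ℤ, dist (g ((R ^ k) p.1)) (g ((R ^ k) p.2)) < δ} ∈ uniformity Y :=
    hRu _ (hgu (Metric.dist_mem_uniformity hδ))
  obtain ⟨n, s, hs⟩ := exists_level_close h1
    ((fun p : D.X 0 × D.X 0 => (ρ p.1, ρ p.2)) ⁻¹' interior
      {p : Y × Y | ∀ k : ℤ, dist (g ((R ^ k) p.1)) (g ((R ^ k) p.2)) < δ})
    (isOpen_interior.preimage ((hρ.1.comp continuous_fst).prodMk (hρ.1.comp continuous_snd)))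
    (fun z => show (ρ z, ρ z) ∈ interior _ from
      refl_mem_uniformity (interior_mem_uniformity hV))
  obtain ⟨v, hv⟩ := hne n
  have hB : ∀ i j, v i = v j →
      ∀ z, |G z - G ((T ^ ((j - i) * (lengthProd D.q n : ℤ))) z)| ≤ δ := by
    intro i j hij z
    have h2 := interior_subset (hs n le_rfl v ⟨_, substIter_mem hv⟩ rfl i j hij)
    set x₀ : D.X 0 := ⟨_, substIter_mem hv⟩
    set J : ℤ := (j - i) * (lengthProd D.q n : ℤ) with hJ
    -- The estimate holds along one orbit by equicontinuity; it is a closed invariant condition, so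
    -- minimality extends it to all points.
    have h3 := hmin.mem_of_mem (C := ⋂ k : ℤ, {z | |G ((T ^ k) z) - G ((T ^ (k + J)) z)| ≤ δ})
      (isClosed_iInter fun k => isClosed_le (((hG.comp (T ^ k).continuous).sub
        (hG.comp (T ^ (k + J)).continuous)).abs) continuous_const) (by
        ext z
        simp only [mem_preimage, mem_iInter, mem_ofPred_eq, zpow_one_add_homeo]
        constructor
        · intro h k
          have := h (k - 1)
          rwa [sub_add_cancel, show k - 1 + J + 1 = k + J by ring] at this
        · intro h k
          have := h (k + 1)
          rwa [show k + 1 + J = k + J + 1 by ring] at this)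
      (x := (T ^ (i * (lengthProd D.q n : ℤ) + s)) x₀) (by
        rw [mem_iInter]
        intro k
        have h4 := (h2 k).le
        rw [← hρT, ← hρT, Real.dist_eq, ← zpow_add_homeo, ← zpow_add_homeo] at h4
        simp only [mem_ofPred_eq, ← zpow_add_homeo]
        rwa [show k + J + (i * (lengthProd D.q n : ℤ) + s) = k + (j * (lengthProd D.q n : ℤ) + s) by
          rw [hJ]; ring]) z
    have h5 := mem_iInter.1 h3 0
    simpa using h5
  obtain ⟨m, hm0, hm⟩ := exists_subgroup_of_colouring v
    (fun i ε => ∀ z, |G z - G ((T ^ (i * (lengthProd D.q n : ℤ))) z)| ≤ ε)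
    (fun i ε h z => by
      have := h ((T ^ (-(i * (lengthProd D.q n : ℤ)))) z)
      rw [zpow_neg_homeo, abs_sub_comm] at this
      rwa [neg_mul])
    (fun i j ε ε' h h' z => by
      have h2 := h z
      have h3 := h' ((T ^ (i * (lengthProd D.q n : ℤ))) z)
      rw [← zpow_add_homeo] at h3
      rw [add_mul, add_comm (i * _)]
      exact (abs_sub_le _ _ _).trans (add_le_add h2 h3))
    (fun i ε ε' h h' z => (h' z).trans h) hδ.le hB
  obtain ⟨c, hcm, f, hfc, hfT, hfcl⟩ := exists_cyclic_decomposition hmin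
    (Nat.mul_pos hm0 (lengthProd_pos D.q_pos n))
  refine ⟨c, Nat.pos_of_dvd_of_pos hcm (Nat.mul_pos hm0 (lengthProd_pos D.q_pos n)), f, hfc, hfT, ?_⟩
  intro hfxy
  have h2 : |G x - G y| ≤ 2 * Nat.card (D.A n) * δ := by
    refine closure_minimal (t := {z | |G x - G z| ≤ 2 * Nat.card (D.A n) * δ}) ?_
      (isClosed_le (continuous_const.sub hG).abs continuous_const) (hfcl x y hfxy)
    rintro _ ⟨j, rfl⟩
    have h3 := hm j x
    simp only [mem_ofPred_eq]
    rwa [show ((m * lengthProd D.q n : ℕ) : ℤ) * j = m * j * (lengthProd D.q n : ℤ) by push_cast; ring]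
  rw [hGx, hGy] at h2
  have h3 : (Nat.card (D.A n) : ℝ) ≤ K := by exact_mod_cast hK n
  have h4 : 2 * (Nat.card (D.A n) : ℝ) * δ ≤ 2 * K * δ := by gcongr
  have h5 : 2 * (K : ℝ) * δ + δ = 1 := by
    simp only [δ]; field_simp
  norm_num at h2
  linarith

/-- The height exists, is unique, and is the largest `d`, with respect to divisibility, that is
coprime to all `q n` and for which the rotation on `ℤ / d ℤ` is a factor. -/
theorem exists_isHeight (hB : D.BoundedAlphabets) (hT : D.TorsionFree) :
    ∃ h : ℕ, 0 < h ∧ (∀ n, Nat.Coprime h (D.q n)) ∧ (∀ h' : ℕ, D.IsHeight h' ↔ h' = h) ∧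
      HasCyclicFactor (D.shiftHomeo 0) h ∧
      ∀ d, 0 < d → (∀ n, Nat.Coprime d (D.q n)) → HasCyclicFactor (D.shiftHomeo 0) d → d ∣ h := by
  obtain ⟨K, hK⟩ := hB
  have hmin := isMinimalHomeo_shiftHomeo (hT.minimal 0)
  have hne : ∀ n, (D.X n).Nonempty := fun n => (hT.minimal n).1
  have : Nonempty (D.X 0) := (hne 0).to_subtype
  let S : Set ℕ := {d | 0 < d ∧ (∀ n, Nat.Coprime d (D.q n)) ∧ HasCyclicFactor (D.shiftHomeo 0) d}
  have hS1 : (1 : ℕ) ∈ S := ⟨one_pos, fun n => Nat.coprime_one_left _,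
    fun _ => 0, continuous_const, fun x => Subsingleton.elim _ _⟩
  have hSb : BddAbove S := ⟨K, fun d hd => le_of_hasCyclicFactor hT.one_lt_q hne hK hd.2.1 hd.2.2⟩
  obtain ⟨hh0, hhc, hhf⟩ := Nat.sSup_mem ⟨1, hS1⟩ hSb
  set h := sSup S
  have hmax : ∀ d, 0 < d → (∀ n, Nat.Coprime d (D.q n)) → HasCyclicFactor (D.shiftHomeo 0) d →
      d ∣ h := by
    intro d hd0 hdc hdf
    have hlcm : d.lcm h ∈ S := ⟨Nat.lcm_pos hd0 hh0,
      fun n => Nat.Coprime.coprime_dvd_left (Nat.lcm_dvd_mul d h)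
        (Nat.Coprime.mul_left (hdc n) (hhc n)), hdf.lcm hmin hd0 hh0 hhf⟩
    have h2 := le_csSup hSb hlcm
    have h3 := Nat.le_of_dvd (Nat.lcm_pos hd0 hh0) (Nat.dvd_lcm_right d h)
    have h4 : d.lcm h = h := le_antisymm h2 h3
    exact h4 ▸ Nat.dvd_lcm_left d h
  have hh : D.IsHeight h := ⟨hh0, hhc, isMaximalEquicontinuousFactor_odometer hmin D.q_pos
    hT.prime_dvd hh0 hhc (hasCyclicFactor_lengthProd hmin hne hK hT.aperiodic hT.prime_dvd) hhf hmax
    (exists_cyclic_separating hT.one_lt_q hmin hne hK)⟩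
  refine ⟨h, hh0, hhc, fun h' => ⟨fun hh' => ?_, ?_⟩, hhf, hmax⟩
  · obtain ⟨h'0, h'c, hM⟩ := hh'
    refine Nat.dvd_antisymm (hmax h' h'0 h'c ?_)
      (HasCyclicFactor.dvd_of_isMaximal (T := D.shiftHomeo 0) hM hh0 hhc hhf)
    obtain ⟨-, π, hπ, -⟩ := hM
    exact HasCyclicFactor.of_addRight (T := D.shiftHomeo 0) hπ
  · rintro rfl
    exact hh

end DirectiveSeq

/-! ### Limit words and the combinatorial height. -/

namespace DirectiveSeq

variable {D : DirectiveSeq}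

theorem IsLimitWord.substIter_eq {u : ∀ n, ℤ → D.A n} (hu : D.IsLimitWord u) (n : ℕ) :
    D.substIter n (u n) = u 0 := by
  induction n with
  | zero => rfl
  | succ n ih => rw [substIter, hu.2, ih]

/-- If all morphisms are injective on letters and all levels are non-empty, there are limit words. -/
theorem exists_isLimitWord (hinj : ∀ n, Function.Injective (D.θ n)) (hne : ∀ n, (D.X n).Nonempty) :
    ∃ u, D.IsLimitWord u := by
  have hcpt : ∀ n, IsCompact (D.substIter n '' D.X n) := fun n =>
    (D.isClosed_X n).isCompact.image (continuous_substIter n)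
  obtain ⟨x, hx⟩ := IsCompact.nonempty_iInter_of_sequence_nonempty_isCompact_isClosed
    (fun n => D.substIter n '' D.X n) (fun n => by
      rintro _ ⟨y, hy, rfl⟩
      exact ⟨_, subst_mem hy, rfl⟩) (fun n => (hne n).image _) (hcpt 0) fun n => (hcpt n).isClosed
  rw [mem_iInter] at hx
  choose u hu hux using hx
  exact ⟨u, hu, fun n => substIter_injective hinj n ((hux (n + 1)).trans (hux n).symm)⟩

/-- An admissible divisor of the return times at some level gives a cyclic factor. -/
theorem hasCyclicFactor_of_mem_returnDivisors (hmin : IsMinimalHomeo (D.shiftHomeo 0))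
    (hinj : ∀ n, Function.Injective (D.θ n)) {n : ℕ}
    (hq : HasCyclicFactor (D.shiftHomeo 0) (lengthProd D.q n)) {u : ∀ n, ℤ → D.A n}
    (hu : D.IsLimitWord u) {d : ℕ} (hd : d ∈ D.returnDivisors u n) :
    HasCyclicFactor (D.shiftHomeo 0) d := by
  obtain ⟨hd0, -, hdk⟩ := hd
  have : Nonempty (D.X 0) := ⟨⟨u 0, hu.1 0⟩⟩
  have hp := lengthProd_pos D.q_pos n
  obtain ⟨c, -, f, hfc, hfT, hcl⟩ := exists_cyclic_decomposition hmin (Nat.mul_pos hp hd0)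
  obtain ⟨e, rfl⟩ := dvd_of_closure (Nat.dvd_mul_right _ d) hq hfT hcl
  let x : D.X 0 := ⟨u 0, hu.1 0⟩
  have h1 : f x = f ((D.shiftHomeo 0 ^ ((lengthProd D.q n * e : ℕ) : ℤ)) x) := by
    rw [cyclic_zpow hfT, Int.cast_natCast, ZMod.natCast_self, add_zero]
  obtain ⟨w, ⟨-, hw⟩, hwx⟩ := closure_zpow_subset (hu.1 n) (x := x) (hu.substIter_eq n).symm
    (hcl _ _ h1)
  have hw' : w = shiftBy e (u n) := by
    apply substIter_injective hinj n
    rw [hwx, shiftHomeo_zpow, substIter_shiftBy, hu.substIter_eq]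
    push_cast
    rw [mul_comm]
  rw [hw'] at hw
  -- The shift of `u n` by `e` is a limit of shifts by multiples of `d`. Reading the letter at `-e`
  -- gives a return time `-e + d * j` of `u n 0`, hence `d ∣ e`.
  have hopen : IsOpen {v : ℤ → D.A n | v (-e) = u n 0} :=
    (isOpen_discrete ({u n 0} : Set (D.A n))).preimage
      (continuous_apply (A := fun _ : ℤ => D.A n) (-(e : ℤ)))
  obtain ⟨_, hv, ⟨j, rfl⟩⟩ := mem_closure_iff.1 hw _ hopen
    (show shiftBy e (u n) (-e) = u n 0 by simp [shiftBy])
  have h2 : (d : ℤ) ∣ -e + d * j := hdk _ hv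
  have h3 : d ∣ e := by
    have := (dvd_add_left (Dvd.intro j rfl)).1 h2
    rw [dvd_neg] at this
    exact_mod_cast this
  exact HasCyclicFactor.of_dvd ⟨f, hfc, hfT⟩ (h3.mul_left _)

/-- Every admissible divisor gives a cyclic factor and, since primes recur, is coprime to all `q k`
and not only to the later ones; so it divides `h`. At a high level `h` itself is admissible. -/
theorem isCombHeightOf {u : ∀ n, ℤ → D.A n} (hu : D.IsLimitWord u)
    (hmin : IsMinimalHomeo (D.shiftHomeo 0))
    (hinj : ∀ n, Function.Injective (D.θ n)) (h1 : ∃ᶠ n in atTop, 1 < D.q n)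
    (hp : ∀ p : ℕ, p.Prime → ∀ k, p ∣ D.q k → ∃ᶠ n in atTop, p ∣ D.q n)
    (hq : ∀ n, HasCyclicFactor (D.shiftHomeo 0) (lengthProd D.q n))
    {h : ℕ} (hh0 : 0 < h) (hcop : ∀ n, Nat.Coprime h (D.q n))
    (hh : HasCyclicFactor (D.shiftHomeo 0) h)
    (hmax : ∀ d, 0 < d → (∀ n, Nat.Coprime d (D.q n)) → HasCyclicFactor (D.shiftHomeo 0) d → d ∣ h) :
    D.IsCombHeightOf u h := by
  have hle : ∀ n, ∀ d ∈ D.returnDivisors u n, d ≤ h := by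
    intro n d hd
    refine Nat.le_of_dvd hh0 (hmax d hd.1 (fun k => ?_)
      (hasCyclicFactor_of_mem_returnDivisors hmin hinj (hq n) hu hd))
    by_contra hk
    obtain ⟨p, hpp, hpd, hpk⟩ := Nat.Prime.not_coprime_iff_dvd.1 hk
    obtain ⟨N, hN, hpN⟩ := frequently_atTop.1 (hp p hpp k hpk) n
    exact Nat.Prime.not_coprime_iff_dvd.2 ⟨p, hpp, hpd, hpN⟩ (hd.2.1 N hN)
  have hbdd : ∀ n, BddAbove (D.returnDivisors u n) := fun n => ⟨h, hle n⟩
  have hone : ∀ n, (1 : ℕ) ∈ D.returnDivisors u n := fun n =>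
    ⟨le_rfl, fun _ _ => Nat.coprime_one_left _, fun _ _ => by simp⟩
  have hgr : ∀ n, IsGreatest (D.returnDivisors u n) (sSup (D.returnDivisors u n)) := fun n =>
    ⟨Nat.sSup_mem ⟨1, hone n⟩ (hbdd n), fun d hd => le_csSup (hbdd n) hd⟩
  obtain ⟨n, hn⟩ := exists_level_dvd_sub h1 hcop hh
  have hmem : h ∈ D.returnDivisors u n := ⟨hh0, fun N _ => hcop N, fun k hk => by
    have := hn n le_rfl (u n) (hu.1 n) 0 k hk.symm
    rwa [sub_zero] at this⟩
  refine ⟨fun n => sSup (D.returnDivisors u n), hgr, ⟨n, ?_⟩, ?_⟩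
  · exact le_antisymm (hle n _ (hgr n).1) ((hgr n).2 hmem)
  · rintro _ ⟨m, rfl⟩
    exact hle m _ (hgr m).1

/-! ### Comparison with the injectivisation. -/

variable (D) in
/-- The projection of the letters of `D` to the letters of the injectivisation. -/
def letterClass (n : ℕ) : D.A n → D.injectivisation.A n := Quotient.mk (D.letterSetoid n)

theorem letterClass_surjective (n : ℕ) : Function.Surjective (D.letterClass n) :=
  Quotient.mk_surjective

theorem letterClass_injective : Function.Injective (D.letterClass 0) := fun _ _ h => Quotient.exact h

theorem injectivisation_θ_letterClass (n : ℕ) (a : D.A (n + 1)) :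
    D.injectivisation.θ n (D.letterClass (n + 1) a) = D.letterClass n ∘ D.θ n a := rfl

variable (D) in
theorem injectivisation_supertile (n k : ℕ) (a : D.A (n + k)) :
    D.injectivisation.supertile n k (D.letterClass (n + k) a) =
      (D.supertile n k a).map (D.letterClass n) := by
  induction k with
  | zero => rfl
  | succ k ih =>
    have h1 : List.ofFn (D.injectivisation.θ (n + k) (D.letterClass (n + k + 1) a)) =
        (List.ofFn (D.θ (n + k) a)).map (D.letterClass (n + k)) := by
      rw [List.map_ofFn, injectivisation_θ_letterClass]
      rfl
    have h2 : (List.ofFn (D.injectivisation.θ (n + k) (D.letterClass (n + k + 1) a))).flatMap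
        (D.injectivisation.supertile n k) =
          ((List.ofFn (D.θ (n + k) a)).flatMap (D.supertile n k)).map (D.letterClass n) := by
      rw [h1, List.flatMap_map, List.map_flatMap]
      simp only [ih]
    exact h2

/-- The letterwise projection of sequences to the alphabets of the injectivisation. -/
def toInjectivisation (n : ℕ) (x : ℤ → D.A n) : ℤ → D.injectivisation.A n :=
  D.letterClass n ∘ x

theorem toInjectivisation_mem {n : ℕ} {x : ℤ → D.A n} (hx : x ∈ D.X n) :
    toInjectivisation n x ∈ D.injectivisation.X n := by
  intro i l
  obtain ⟨k, hk, a, ha⟩ := hx i l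
  refine ⟨k, hk, D.letterClass (n + k) a, ?_⟩
  rw [injectivisation_supertile]
  convert ha.map (D.letterClass n) using 1
  rw [List.map_ofFn]
  rfl

theorem continuous_toInjectivisation (n : ℕ) : Continuous (toInjectivisation (D := D) n) :=
  continuous_pi fun m => (continuous_of_discreteTopology (f := D.letterClass n)).comp
    (continuous_apply m)

theorem exists_toInjectivisation_eq {y : ℤ → D.injectivisation.A 0} (hy : y ∈ D.injectivisation.X 0) :
    ∃ x ∈ D.X 0, toInjectivisation 0 x = y := by
  choose x hx using fun m => letterClass_surjective 0 (y m)
  refine ⟨x, fun i l => ?_, funext hx⟩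
  obtain ⟨k, hk, a, ha⟩ := hy i l
  obtain ⟨a, rfl⟩ := letterClass_surjective (0 + k) a
  rw [injectivisation_supertile] at ha
  obtain ⟨l', hl', he⟩ := List.infix_map_iff.1 ha
  refine ⟨k, hk, a, ?_⟩
  convert hl'
  apply List.map_injective_iff.2 letterClass_injective
  rw [← he, List.map_ofFn]
  congr 1
  funext j
  exact hx _

variable (D) in
/-- The levels `0` of a directive sequence and of its injectivisation are conjugate. -/
theorem exists_homeomorph_injectivisation : ∃ e : D.X 0 ≃ₜ D.injectivisation.X 0,
    ∀ x, e (D.shiftHomeo 0 x) = D.injectivisation.shiftHomeo 0 (e x) := by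
  let f : D.X 0 → D.injectivisation.X 0 := fun x => ⟨toInjectivisation 0 x.1, toInjectivisation_mem x.2⟩
  have hf : Continuous f :=
    ((continuous_toInjectivisation 0).comp continuous_subtype_val).subtype_mk _
  have hb : Function.Bijective f := by
    refine ⟨fun x y hxy => Subtype.ext (funext fun m => ?_), fun y => ?_⟩
    · exact letterClass_injective (congrFun (congrArg Subtype.val hxy) m)
    · obtain ⟨x, hx, hxy⟩ := exists_toInjectivisation_eq y.2
      exact ⟨⟨x, hx⟩, Subtype.ext hxy⟩
  exact ⟨Continuous.homeoOfEquivCompactToT2 (f := Equiv.ofBijective f hb) hf, fun x => rfl⟩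

end DirectiveSeq

theorem IsMinimalHomeo.conj {X Y : Type*} [TopologicalSpace X] [TopologicalSpace Y] {T : X ≃ₜ X}
    {S : Y ≃ₜ Y} (hT : IsMinimalHomeo T) (e : X ≃ₜ Y) (he : ∀ x, e (T x) = S (e x)) :
    IsMinimalHomeo S := by
  intro C hC hinv
  have := hT (e ⁻¹' C) (hC.preimage e.continuous) (by
    ext x
    simp only [mem_preimage, he]
    conv_rhs => rw [← hinv]
    rfl)
  rcases this with h | h
  · exact Or.inl (e.surjective.preimage_injective (by rw [h, preimage_empty]))
  · exact Or.inr (e.surjective.preimage_injective (by rw [h, preimage_univ]))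

end

theorem theorem5p7 (D : DirectiveSeq) (hB : D.BoundedAlphabets) (hT : D.TorsionFree) :
    ∃ h : ℕ, (∀ h' : ℕ, D.IsHeight h' ↔ h' = h) ∧
      (∃ u, D.injectivisation.IsLimitWord u) ∧
      ∀ u, D.injectivisation.IsLimitWord u → D.injectivisation.IsCombHeightOf u h := by
  have hmin := DirectiveSeq.isMinimalHomeo_shiftHomeo (hT.minimal 0)
  have hne : ∀ n, (D.X n).Nonempty := fun n => (hT.minimal n).1
  obtain ⟨h, hh0, hcop, huniq, hh, hmax⟩ := DirectiveSeq.exists_isHeight hB hT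
  obtain ⟨K, hK⟩ := hB
  obtain ⟨e, he⟩ := D.exists_homeomorph_injectivisation
  have he' : ∀ y, e.symm (D.injectivisation.shiftHomeo 0 y) = D.shiftHomeo 0 (e.symm y) := fun y => by
    apply e.injective
    rw [he, e.apply_symm_apply, e.apply_symm_apply]
  refine ⟨h, huniq, DirectiveSeq.exists_isLimitWord D.injectivisation_injective fun n => ?_,
    fun u hu => ?_⟩
  · obtain ⟨x, hx⟩ := hne n
    exact ⟨_, DirectiveSeq.toInjectivisation_mem hx⟩
  -- Cyclic factors are conjugacy invariants of level `0` and the lengths `q n` agree, so the `h`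
  -- found for `D` also serves for the injectivisation.
  · exact DirectiveSeq.isCombHeightOf hu (hmin.conj e he) D.injectivisation_injective hT.one_lt_q
      hT.prime_dvd (fun n => (DirectiveSeq.hasCyclicFactor_lengthProd hmin hne hK hT.aperiodic
        hT.prime_dvd n).conj e.symm e.symm.continuous he') hh0 hcop
      (hh.conj e.symm e.symm.continuous he') fun d hd0 hdc hd =>
        hmax d hd0 hdc (hd.conj e e.continuous he)
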